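/- Let $F$ be Thompson's group: the group of all strictly increasing homeomorphisms of $[0,1]$ that are piecewise linear with finitely many breakpoints, all of them dyadic rationals, and whose slopes are integer powers of $2$. Let $x_0,x_1\in F$ be the standard generators $$x_0(t)=\begin{cases}\frac t2,&0\le t\le\frac12,\\ t-\frac14,&\frac12\le t\le\frac34,\\ 2t-1,&\frac34\le t\le1,\end{cases}\qquad x_1(t)=\begin{cases}t,&0\le t\le\frac12,\\ \frac t2+\frac14,&\frac12\le t\le\frac34,\\ t-\frac18,&\frac34\le t\le\frac78,\\ 2t-1,&\frac78\le t\le1.\end{cases}$$ The standard action of $F$ on the Cantor set $\{0,1\}^\omega$ is the one induced by the action on $[0,1]$ through binary expansions: $f(w)$ is the binary expansion of $f(0.w)$, where $f(w)$ ends in $000\ldots$ if and only if $w$ does. Thus $x_0$ acts by $0w\mapsto00w$, $10w\mapsto01w$, $11w\mapsto1w$, and $x_1$ acts by $0w\mapsto0w$, $10w\mapsto100w$, $110w\mapsto101w$, $111w\mapsto11w$. For $y\in[0,1]$ let $\Gamma_y$ be the pointed Schreier graph of $y$: its vertex set is the orbit $Fy$, its base vertex is $y$, and for each vertex $u$ and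 $i\in\{0,1\}$ there is an arrow labeled $x_i$ from $u$ to $x_i(u)$. The connected pointed graphs with arrows labeled by $x_0,x_1$, such that every vertex has exactly one outgoing and exactly one incoming arrow of each label, form, up to isomorphism, a space $\mathcal T$ with the topology of the metric $d=2^{-n}$, where $n$ is the largest integer for which the balls of radius $n$ around the base vertices are isomorphic as labeled pointed graphs. For $x\in(0,1)$ put $\mathcal C_x=\{\Gamma_y : y\in Fx\}\subset\mathcal T$. The perfect kernel of a closed set is what remains after removing isolated points transfinitely often. Let $\mathcal D$ be the perfect kernel of $\overline{\mathcal C_{1/2}}$. **Theorem.** For every $x\in(0,1)$ the perfect kernel of $\overline{\mathcal C_x}$ is equal to $\mathcal D$. The action of $F$ on $\mathcal C_x$ by shifting the base vertex, $\Gamma_y\mapsto\Gamma_{f(y)}$ for $f\in F$, extends uniquely to an action of $F$ by homeomorphisms on $\overline{\mathcal C_x}$ (the Schreier dynamical system of the orbit of $x$). This action preserves $\mathcal D$, and its restriction to $\mathcal D$ is topologically conjugate to the standard action of $F$ on $\{0,1\}^\omega$: there is a homeomorphism $\psi:\mathcal D\to\{0,1\}^\omega$, which can be chosen independently of $x$,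 such that $\psi(f\cdot\Gamma)=f(\psi(\Gamma))$ for all $f\in F$ and $\Gamma\in\mathcal D$. -/

import Mathlib

open Set Topology unitInterval

noncomputable section

/-! ### Thompson's group `F` -/

/-- Dyadic rational numbers, as real numbers. -/
def IsDyadic (r : ℝ) : Prop := ∃ (k : ℤ) (n : ℕ), r = k / 2 ^ n

theorem IsDyadic.add {r s : ℝ} (hr : IsDyadic r) (hs : IsDyadic s) : IsDyadic (r + s) := by
  obtain ⟨k, n, rfl⟩ := hr
  obtain ⟨l, m, rfl⟩ := hs
  refine ⟨k * 2 ^ m + l * 2 ^ n, n + m, ?_⟩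
  push_cast
  field_simp
  ring

theorem IsDyadic.neg {r : ℝ} (hr : IsDyadic r) : IsDyadic (-r) := by
  obtain ⟨k, n, rfl⟩ := hr
  exact ⟨-k, n, by push_cast; ring⟩

theorem IsDyadic.mul {r s : ℝ} (hr : IsDyadic r) (hs : IsDyadic s) : IsDyadic (r * s) := by
  obtain ⟨k, n, rfl⟩ := hr
  obtain ⟨l, m, rfl⟩ := hs
  refine ⟨k * l, n + m, ?_⟩
  push_cast
  field_simp
  ring

theorem IsDyadic.two_zpow (k : ℤ) : IsDyadic ((2 : ℝ) ^ k) := by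
  obtain ⟨n, rfl | rfl⟩ := k.eq_nat_or_neg
  · exact ⟨2 ^ n, 0, by simp⟩
  · exact ⟨1, n, by simp⟩

theorem IsDyadic.zero : IsDyadic 0 := ⟨0, 0, by simp⟩

/-- `f` is piecewise linear with dyadic breakpoints and slopes integer powers of `2`: there is a
finite set `B` of dyadic rationals such that on every interval `[s, t]` without points of `B` in
its interior, `f` has the form `u ↦ 2 ^ k * u + c` with `k` an integer. -/
def IsDyadicPL (f : I → I) : Prop :=
  ∃ B : Finset I, (∀ b ∈ B, IsDyadic b) ∧
    ∀ s t : I, s < t → (∀ b ∈ B, ¬ (s < b ∧ b < t)) →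
      ∃ (k : ℤ) (c : ℝ), ∀ u ∈ Icc s t, (f u : ℝ) = 2 ^ k * (u : ℝ) + c

theorem IsDyadicPL.isDyadic_apply {f : I → I} (hf : IsDyadicPL f) (h0 : f 0 = 0) {t : I}
    (ht : IsDyadic t) : IsDyadic (f t) := by
  classical
  obtain ⟨B, hB, hlin⟩ := hf
  have key : ∀ (n : ℕ) (t : I), (B.filter (· < t)).card ≤ n → IsDyadic t → IsDyadic (f t) := by
    have step : ∀ s t : I, s < t → (∀ b ∈ B, ¬ (s < b ∧ b < t)) → IsDyadic s → IsDyadic t →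
        IsDyadic (f s) → IsDyadic (f t) := by
      intro s t hst hno hs ht hfs
      obtain ⟨k, c, hk⟩ := hlin s t hst hno
      have h1 := hk s ⟨le_rfl, hst.le⟩
      have h2 := hk t ⟨hst.le, le_rfl⟩
      have : (f t : ℝ) = f s + 2 ^ k * ((t : ℝ) + -s) := by rw [h1, h2]; ring
      rw [this]
      exact hfs.add ((IsDyadic.two_zpow k).mul (ht.add hs.neg))
    have zero_case : ∀ t : I, (∀ b ∈ B, ¬ (b < t)) → IsDyadic t → IsDyadic (f t) := by
      intro t hno ht
      rcases (unitInterval.nonneg' (t := t)).eq_or_lt with h | h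
      · rw [← h, h0]; exact IsDyadic.zero
      · exact step 0 t h (fun b hb hbt => hno b hb hbt.2) IsDyadic.zero ht
          (by rw [h0]; exact IsDyadic.zero)
    intro n
    induction n with
    | zero =>
      intro t hc ht
      refine zero_case t (fun b hb hbt => ?_) ht
      have : b ∈ B.filter (· < t) := by simp [hb, hbt]
      rw [Finset.card_eq_zero.mp (Nat.le_zero.mp hc)] at this
      simp at this
    | succ n ih =>
      intro t hc ht
      by_cases hne : (B.filter (· < t)).Nonempty
      · set s := (B.filter (· < t)).max' hne with hs
        have hsm : s ∈ B.filter (· < t) := Finset.max'_mem _ _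
        have hsB : s ∈ B ∧ s < t := by simpa using hsm
        refine step s t hsB.2 (fun b hb hbt => ?_) (hB s hsB.1) ht (ih s ?_ (hB s hsB.1))
        · have : b ≤ s := Finset.le_max' _ b (by simp [hb, hbt.2])
          exact absurd hbt.1 (not_lt.mpr this)
        · have : (B.filter (· < s)).card < (B.filter (· < t)).card := by
            apply Finset.card_lt_card
            refine ⟨fun b hb => ?_, fun h => ?_⟩
            · simp only [Finset.mem_filter] at hb ⊢
              exact ⟨hb.1, hb.2.trans hsB.2⟩
            · have := h hsm
              simp at this
          omega
      · refine zero_case t (fun b hb hbt => hne ⟨b, by simp [hb, hbt]⟩) ht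
  exact key _ t le_rfl ht

theorem strictMono_homeomorph_zero (f : I ≃ₜ I) (hf : StrictMono f) : f 0 = 0 := by
  apply le_antisymm _ unitInterval.nonneg'
  calc f 0 ≤ f (f.symm 0) := hf.monotone unitInterval.nonneg'
    _ = 0 := f.apply_symm_apply 0

theorem strictMono_homeomorph_symm (f : I ≃ₜ I) (hf : StrictMono f) : StrictMono f.symm := by
  intro a b hab
  rw [← hf.lt_iff_lt]
  simpa using hab

theorem IsDyadicPL.symm {f : I ≃ₜ I} (hm : StrictMono f) (hf : IsDyadicPL f) :
    IsDyadicPL f.symm := by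
  classical
  have h0 := strictMono_homeomorph_zero f hm
  have hf' := hf
  obtain ⟨B, hB, hlin⟩ := hf
  refine ⟨B.image f, ?_, ?_⟩
  · intro b hb
    obtain ⟨a, ha, rfl⟩ := Finset.mem_image.mp hb
    exact hf'.isDyadic_apply h0 (hB a ha)
  · intro s t hst hno
    have hms := strictMono_homeomorph_symm f hm
    obtain ⟨k, c, hk⟩ := hlin (f.symm s) (f.symm t) (hms hst) (fun b hb hbt => by
      refine hno (f b) (Finset.mem_image_of_mem _ hb) ⟨?_, ?_⟩
      · simpa using hm hbt.1
      · simpa using hm hbt.2)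
    refine ⟨-k, -(2 ^ (-k) * c), fun u hu => ?_⟩
    have := hk (f.symm u) ⟨hms.monotone hu.1, hms.monotone hu.2⟩
    rw [f.apply_symm_apply] at this
    rw [this, zpow_neg]
    field_simp
    ring

/-- Thompson's group `F`: the increasing homeomorphisms of `[0, 1]` that are piecewise linear with
finitely many breakpoints, all dyadic, and with slopes integer powers of `2`. The product
`f * g` is the map `t ↦ f (g t)`. -/
def ThompsonF : Subgroup (I ≃ₜ I) where
  carrier := {f | StrictMono f ∧ IsDyadicPL f}
  one_mem' := ⟨fun _ _ h => h, ∅, by simp, fun s t _ _ => ⟨0, 0, by simp⟩⟩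
  inv_mem' := fun {f} hf => ⟨strictMono_homeomorph_symm f hf.1, hf.2.symm hf.1⟩
  mul_mem' := by
    classical
    rintro f g ⟨hfm, hf⟩ ⟨hgm, hg⟩
    refine ⟨hfm.comp hgm, ?_⟩
    have hgs := hg.symm hgm
    have hgsm := strictMono_homeomorph_symm g hgm
    have h0 := strictMono_homeomorph_zero g.symm hgsm
    obtain ⟨B, hB, hlin⟩ := hf
    obtain ⟨C, hC, hlin'⟩ := hg
    refine ⟨C ∪ B.image g.symm, ?_, ?_⟩
    · intro b hb
      rcases Finset.mem_union.mp hb with hb | hb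
      · exact hC b hb
      · obtain ⟨a, ha, rfl⟩ := Finset.mem_image.mp hb
        exact hgs.isDyadic_apply h0 (hB a ha)
    · intro s t hst hno
      obtain ⟨k, c, hk⟩ := hlin' s t hst
        (fun b hb => hno b (Finset.mem_union_left _ hb))
      obtain ⟨l, d, hl⟩ := hlin (g s) (g t) (hgm hst) (fun b hb hbt => by
        refine hno (g.symm b) (Finset.mem_union_right _ (Finset.mem_image_of_mem _ hb)) ⟨?_, ?_⟩
        · simpa using hgsm hbt.1
        · simpa using hgsm hbt.2)
      refine ⟨l + k, 2 ^ l * c + d, fun u hu => ?_⟩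
      have h1 := hk u hu
      have h2 := hl (g u) ⟨hgm.monotone hu.1, hgm.monotone hu.2⟩
      simp only [Homeomorph.mul_apply]
      rw [h2, h1, zpow_add₀ (by norm_num)]
      ring

/-- The action of `F` on the unit interval. -/
instance : MulAction ThompsonF I where
  smul f t := f.1 t
  one_smul _ := rfl
  mul_smul _ _ _ := rfl

theorem ThompsonF.smul_def (f : ThompsonF) (t : I) : f • t = f.1 t := rfl

/-- The map `x₀` on real numbers. -/
def x₀Fun (t : ℝ) : ℝ := if t ≤ 1 / 2 then t / 2 else if t ≤ 3 / 4 then t - 1 / 4 else 2 * t - 1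

/-- The map `x₁` on real numbers. -/
def x₁Fun (t : ℝ) : ℝ :=
  if t ≤ 1 / 2 then t else if t ≤ 3 / 4 then t / 2 + 1 / 4 else
    if t ≤ 7 / 8 then t - 1 / 8 else 2 * t - 1

theorem x₀Fun_mem (t : I) : x₀Fun t ∈ I := by
  have h0 := t.2.1
  have h1 := t.2.2
  unfold x₀Fun
  split_ifs <;> constructor <;> linarith

theorem x₁Fun_mem (t : I) : x₁Fun t ∈ I := by
  have h0 := t.2.1
  have h1 := t.2.2
  unfold x₁Fun
  split_ifs <;> constructor <;> linarith

theorem x₀Fun_strictMono : StrictMono (fun t : I => (⟨x₀Fun t, x₀Fun_mem t⟩ : I)) := by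
  intro a b hab
  have hab : (a : ℝ) < b := hab
  change x₀Fun a < x₀Fun b
  unfold x₀Fun
  split_ifs <;> linarith

theorem x₁Fun_strictMono : StrictMono (fun t : I => (⟨x₁Fun t, x₁Fun_mem t⟩ : I)) := by
  intro a b hab
  have hab : (a : ℝ) < b := hab
  change x₁Fun a < x₁Fun b
  unfold x₁Fun
  split_ifs <;> linarith

theorem x₀Fun_surjective : Function.Surjective (fun t : I => (⟨x₀Fun t, x₀Fun_mem t⟩ : I)) := by
  rintro ⟨s, h0, h1⟩
  have hm : (if s ≤ 1 / 4 then 2 * s else if s ≤ 1 / 2 then s + 1 / 4 else (s + 1) / 2) ∈ I := by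
    split_ifs <;> constructor <;> linarith
  refine ⟨⟨_, hm⟩, Subtype.ext ?_⟩
  simp only [x₀Fun]
  split_ifs <;> linarith

theorem x₁Fun_surjective : Function.Surjective (fun t : I => (⟨x₁Fun t, x₁Fun_mem t⟩ : I)) := by
  rintro ⟨s, h0, h1⟩
  have hm : (if s ≤ 1 / 2 then s else if s ≤ 5 / 8 then 2 * s - 1 / 2 else
      if s ≤ 3 / 4 then s + 1 / 8 else (s + 1) / 2) ∈ I := by
    split_ifs <;> constructor <;> linarith
  refine ⟨⟨_, hm⟩, Subtype.ext ?_⟩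
  simp only [x₁Fun]
  split_ifs <;> linarith

theorem x₀Fun_isDyadicPL : IsDyadicPL (fun t : I => (⟨x₀Fun t, x₀Fun_mem t⟩ : I)) := by
  classical
  refine ⟨{⟨1 / 2, by norm_num, by norm_num⟩, ⟨3 / 4, by norm_num, by norm_num⟩}, ?_, ?_⟩
  · intro b hb
    simp only [Finset.mem_insert, Finset.mem_singleton] at hb
    rcases hb with rfl | rfl
    · exact ⟨1, 1, by norm_num⟩
    · exact ⟨3, 2, by norm_num⟩
  · intro s t hst hno
    have hst : (s : ℝ) < t := hst
    simp only [Finset.mem_insert, Finset.mem_singleton, forall_eq_or_imp, forall_eq,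
      ← Subtype.coe_lt_coe, not_and, not_lt] at hno
    obtain ⟨ha, hb⟩ := hno
    have hu : ∀ u ∈ Icc s t, (s : ℝ) ≤ u ∧ (u : ℝ) ≤ t := fun u h => ⟨h.1, h.2⟩
    rcases lt_or_ge (s : ℝ) (1 / 2) with h | h
    · refine ⟨-1, 0, fun u hu' => ?_⟩
      have := hu u hu'
      have := ha h
      simp only [x₀Fun]
      rw [if_pos (by linarith)]
      norm_num
      ring
    rcases lt_or_ge (s : ℝ) (3 / 4) with h' | h'
    · refine ⟨0, -1 / 4, fun u hu' => ?_⟩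
      have := hu u hu'
      have := hb h'
      simp only [x₀Fun, zpow_zero]
      split_ifs <;> linarith
    · refine ⟨1, -1, fun u hu' => ?_⟩
      have := hu u hu'
      simp only [x₀Fun, zpow_one]
      split_ifs <;> linarith

theorem x₁Fun_isDyadicPL : IsDyadicPL (fun t : I => (⟨x₁Fun t, x₁Fun_mem t⟩ : I)) := by
  classical
  refine ⟨{⟨1 / 2, by norm_num, by norm_num⟩, ⟨3 / 4, by norm_num, by norm_num⟩,
    ⟨7 / 8, by norm_num, by norm_num⟩}, ?_, ?_⟩
  · intro b hb
    simp only [Finset.mem_insert, Finset.mem_singleton] at hb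
    rcases hb with rfl | rfl | rfl
    · exact ⟨1, 1, by norm_num⟩
    · exact ⟨3, 2, by norm_num⟩
    · exact ⟨7, 3, by norm_num⟩
  · intro s t hst hno
    have hst : (s : ℝ) < t := hst
    simp only [Finset.mem_insert, Finset.mem_singleton, forall_eq_or_imp, forall_eq,
      ← Subtype.coe_lt_coe, not_and, not_lt] at hno
    obtain ⟨ha, hb, hc⟩ := hno
    have hu : ∀ u ∈ Icc s t, (s : ℝ) ≤ u ∧ (u : ℝ) ≤ t := fun u h => ⟨h.1, h.2⟩
    rcases lt_or_ge (s : ℝ) (1 / 2) with h | h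
    · refine ⟨0, 0, fun u hu' => ?_⟩
      have := hu u hu'
      have := ha h
      simp only [x₁Fun, zpow_zero]
      split_ifs <;> linarith
    rcases lt_or_ge (s : ℝ) (3 / 4) with h' | h'
    · refine ⟨-1, 1 / 4, fun u hu' => ?_⟩
      have := hu u hu'
      have := hb h'
      simp only [x₁Fun, zpow_neg, zpow_one]
      split_ifs <;> linarith
    rcases lt_or_ge (s : ℝ) (7 / 8) with h'' | h''
    · refine ⟨0, -1 / 8, fun u hu' => ?_⟩
      have := hu u hu'
      have := hc h''
      simp only [x₁Fun, zpow_zero]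
      split_ifs <;> linarith
    · refine ⟨1, -1, fun u hu' => ?_⟩
      have := hu u hu'
      simp only [x₁Fun, zpow_one]
      split_ifs <;> linarith

/-- The generator `x₀` of `F`. -/
def x₀ : ThompsonF :=
  ⟨(StrictMono.orderIsoOfSurjective _ x₀Fun_strictMono x₀Fun_surjective).toHomeomorph,
    x₀Fun_strictMono, x₀Fun_isDyadicPL⟩

/-- The generator `x₁` of `F`. -/
def x₁ : ThompsonF :=
  ⟨(StrictMono.orderIsoOfSurjective _ x₁Fun_strictMono x₁Fun_surjective).toHomeomorph,
    x₁Fun_strictMono, x₁Fun_isDyadicPL⟩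

theorem coe_x₀_smul (t : I) : ((x₀ • t : I) : ℝ) = x₀Fun t := rfl

theorem coe_x₁_smul (t : I) : ((x₁ • t : I) : ℝ) = x₁Fun t := rfl

/-! ### The standard action of `F` on the Cantor set -/

/-- The Cantor set `{0, 1}^ω` of infinite binary words, with the product topology. -/
abbrev BinSeq := ℕ → Fin 2

/-- The point of `[0, 1]` with binary expansion `0.w₀w₁w₂…`. -/
def binVal (w : BinSeq) : I := ⟨Real.ofDigits w, Real.ofDigits_nonneg w, Real.ofDigits_le_one w⟩

/-- The word `w` ends in `000…`. -/
def EndsInZeros (w : BinSeq) : Prop := ∃ N, ∀ n ≥ N, w n = 0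

/-- The word `aw`. -/
def consWord (a : Fin 2) (w : BinSeq) : BinSeq
  | 0 => a
  | n + 1 => w n

theorem coe_binVal_shift (w : BinSeq) :
    (binVal w : ℝ) = (w 0 : ℝ) / 2 + (binVal fun i => w (i + 1)) / 2 := by
  have h := Real.ofDigits_eq_sum_add_ofDigits w 1
  simp only [Finset.sum_range_one, Real.ofDigitsTerm] at h
  simp only [binVal]
  rw [h]
  norm_num
  ring

theorem coe_binVal_consWord (a : Fin 2) (w : BinSeq) :
    (binVal (consWord a w) : ℝ) = (a : ℝ) / 2 + binVal w / 2 := by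
  rw [coe_binVal_shift]
  rfl

theorem fin_two_cases (a : Fin 2) : (a = 0 ∧ ((a : ℕ) : ℝ) = 0) ∨ (a = 1 ∧ ((a : ℕ) : ℝ) = 1) := by
  fin_cases a <;> simp

theorem binVal_eq_zero {w : BinSeq} (h : (binVal w : ℝ) = 0) (n : ℕ) : w n = 0 := by
  induction n generalizing w with
  | zero =>
    have h1 := coe_binVal_shift w
    have h2 := (binVal fun i => w (i + 1)).2.1
    rcases fin_two_cases (w 0) with ⟨h3, h4⟩ | ⟨h3, h4⟩
    · exact h3
    · rw [h4] at h1; linarith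
  | succ n ih =>
    have h1 := coe_binVal_shift w
    have h2 := (binVal fun i => w (i + 1)).2.1
    refine ih (w := fun i => w (i + 1)) ?_
    rcases fin_two_cases (w 0) with ⟨h3, h4⟩ | ⟨h3, h4⟩ <;> rw [h4] at h1 <;> linarith

theorem binVal_eq_one {w : BinSeq} (h : (binVal w : ℝ) = 1) (n : ℕ) : w n = 1 := by
  induction n generalizing w with
  | zero =>
    have h1 := coe_binVal_shift w
    have h2 := (binVal fun i => w (i + 1)).2.2
    rcases fin_two_cases (w 0) with ⟨h3, h4⟩ | ⟨h3, h4⟩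
    · rw [h4] at h1; linarith
    · exact h3
  | succ n ih =>
    have h1 := coe_binVal_shift w
    have h2 := (binVal fun i => w (i + 1)).2.2
    refine ih (w := fun i => w (i + 1)) ?_
    rcases fin_two_cases (w 0) with ⟨h3, h4⟩ | ⟨h3, h4⟩ <;> rw [h4] at h1 <;> linarith

theorem endsInZeros_shift_iff (w : BinSeq) (m : ℕ) :
    EndsInZeros (fun i => w (i + m)) ↔ EndsInZeros w := by
  constructor
  · rintro ⟨N, hN⟩
    refine ⟨N + m, fun n hn => ?_⟩
    have : w (n - m + m) = 0 := hN (n - m) (by omega)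
    rwa [Nat.sub_add_cancel (by omega)] at this
  · rintro ⟨N, hN⟩
    exact ⟨N, fun n hn => hN (n + m) (by omega)⟩

theorem endsInZeros_consWord_iff (a : Fin 2) (w : BinSeq) :
    EndsInZeros (consWord a w) ↔ EndsInZeros w :=
  (endsInZeros_shift_iff (consWord a w) 1).symm

/-- Two different expansions of the same number are told apart by `EndsInZeros`. -/
theorem binVal_injective_aux {w v : BinSeq} (h : (binVal w : ℝ) = binVal v)
    (h' : EndsInZeros w ↔ EndsInZeros v) (n : ℕ) : w n = v n := by
  have key : ∀ w v : BinSeq, (binVal w : ℝ) = binVal v → (EndsInZeros w ↔ EndsInZeros v) →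
      w 0 = 0 → w 0 = v 0 := by
    intro w v h h' hw
    by_contra hne
    rcases fin_two_cases (v 0) with ⟨hv, hv'⟩ | ⟨hv, hv'⟩
    · exact hne (hw.trans hv.symm)
    have e1 := coe_binVal_shift w
    have e2 := coe_binVal_shift v
    rw [hw] at e1
    rw [hv'] at e2
    simp only [Fin.val_zero, Nat.cast_zero] at e1
    have b1 := (binVal fun i => w (i + 1)).2.2
    have b2 := (binVal fun i => v (i + 1)).2.1
    have z := binVal_eq_zero (w := fun i => v (i + 1)) (by linarith)
    have o := binVal_eq_one (w := fun i => w (i + 1)) (by linarith)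
    have hv0 : EndsInZeros v := ⟨1, fun n hn => by
      have : v (n - 1 + 1) = 0 := z (n - 1)
      rwa [Nat.sub_add_cancel hn] at this⟩
    obtain ⟨N, hN⟩ := h'.mpr hv0
    have := hN (N + 1) (by omega)
    rw [o N] at this
    exact absurd this (by decide)
  have key2 : ∀ w v : BinSeq, (binVal w : ℝ) = binVal v → (EndsInZeros w ↔ EndsInZeros v) →
      w 0 = v 0 := by
    intro w v h h'
    rcases fin_two_cases (w 0) with ⟨hw, -⟩ | ⟨hw, -⟩
    · exact key w v h h' hw
    · rcases fin_two_cases (v 0) with ⟨hv, -⟩ | ⟨hv, -⟩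
      · exact (key v w h.symm h'.symm hv).symm
      · rw [hw, hv]
  induction n generalizing w v with
  | zero => exact key2 w v h h'
  | succ n ih =>
    have h0 := key2 w v h h'
    have e1 := coe_binVal_shift w
    have e2 := coe_binVal_shift v
    rw [h0] at e1
    refine ih (w := fun i => w (i + 1)) (v := fun i => v (i + 1)) (by linarith) ?_
    rw [endsInZeros_shift_iff w 1, endsInZeros_shift_iff v 1]
    exact h'

theorem binVal_eq_of_endsInZeros {w v : BinSeq} (h : binVal w = binVal v)
    (h' : EndsInZeros w ↔ EndsInZeros v) : w = v :=
  funext (binVal_injective_aux (congrArg Subtype.val h) h')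

theorem EndsInZeros.isDyadic {w : BinSeq} (h : EndsInZeros w) : IsDyadic (binVal w) := by
  obtain ⟨N, hN⟩ := h
  induction N generalizing w with
  | zero =>
    have : w = fun _ => 0 := funext fun n => hN n (by omega)
    subst this
    have : (binVal (fun _ => 0) : ℝ) = 0 := by
      simp [binVal, Real.ofDigits, Real.ofDigitsTerm]
    rw [this]
    exact IsDyadic.zero
  | succ N ih =>
    rw [coe_binVal_shift]
    have h1 := ih (w := fun i => w (i + 1)) (fun n hn => hN (n + 1) (by omega))
    have h2 : IsDyadic ((w 0 : ℕ) : ℝ) := ⟨(w 0 : ℕ), 0, by simp⟩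
    have h3 : IsDyadic (1 / 2) := ⟨1, 1, by norm_num⟩
    have := (h2.mul h3).add (h1.mul h3)
    convert this using 1
    ring

theorem EndsInZeros.lt_one {w : BinSeq} (h : EndsInZeros w) : (binVal w : ℝ) < 1 := by
  refine lt_of_le_of_ne (binVal w).2.2 fun h1 => ?_
  obtain ⟨N, hN⟩ := h
  have := hN N le_rfl
  rw [binVal_eq_one h1 N] at this
  exact absurd this (by decide)

theorem exists_endsInZeros {t : I} (ht : IsDyadic t) (h1 : (t : ℝ) < 1) :
    ∃ w, binVal w = t ∧ EndsInZeros w := by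
  refine ⟨Real.digits t 2, Subtype.ext (Real.ofDigits_digits (by norm_num) ⟨t.2.1, h1⟩), ?_⟩
  obtain ⟨k, n, hk⟩ := ht
  have hk0 : 0 ≤ k := by
    have h0 := t.2.1
    rw [hk] at h0
    by_contra hneg
    have : (k : ℝ) < 0 := by exact_mod_cast not_le.mp hneg
    have : (k : ℝ) / 2 ^ n < 0 := div_neg_of_neg_of_pos this (by positivity)
    linarith
  obtain ⟨m, rfl⟩ := Int.eq_ofNat_of_zero_le hk0
  refine ⟨n, fun i hi => ?_⟩
  obtain ⟨j, rfl⟩ := Nat.exists_eq_add_of_le hi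
  have : (t : ℝ) * (2 : ℕ) ^ (n + j + 1) = ((2 * (m * 2 ^ j) : ℕ) : ℝ) := by
    rw [hk]
    push_cast
    field_simp
    ring
  simp only [Real.digits]
  rw [this, Nat.floor_natCast]
  apply Fin.ext
  simp [Fin.ofNat]

theorem exists_not_endsInZeros {t : I} (h0 : 0 < (t : ℝ)) :
    ∃ w, binVal w = t ∧ ¬ EndsInZeros w := by
  have key : ∀ (N : ℕ) (w : BinSeq), (∀ n ≥ N, w n = 0) → 0 < (binVal w : ℝ) →
      ∃ v, (binVal v : ℝ) = binVal w ∧ ¬ EndsInZeros v := by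
    intro N
    induction N with
    | zero =>
      intro w hw h0
      have : w = fun _ => 0 := funext fun n => hw n (by omega)
      subst this
      simp [binVal, Real.ofDigits, Real.ofDigitsTerm] at h0
    | succ N ih =>
      intro w hw h0
      have e := coe_binVal_shift w
      rcases ((binVal fun i => w (i + 1)).2.1).eq_or_lt with hz | hz
      · refine ⟨consWord 0 fun _ => 1, ?_, ?_⟩
        · rw [coe_binVal_consWord]
          have h1 : (binVal (fun _ => 1) : ℝ) = 1 := Real.ofDigits_const_last_eq_one 1
          rw [h1, e, ← hz]
          rcases fin_two_cases (w 0) with ⟨-, h4⟩ | ⟨-, h4⟩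
          · rw [h4, ← hz] at e; linarith
          · rw [h4]; simp
        · rw [endsInZeros_consWord_iff]
          rintro ⟨M, hM⟩
          exact absurd (hM M le_rfl : (1 : Fin 2) = 0) Fin.zero_ne_one.symm
      · obtain ⟨v, hv, hv'⟩ := ih (fun i => w (i + 1)) (fun n hn => hw (n + 1) (by omega)) hz
        refine ⟨consWord (w 0) v, ?_, ?_⟩
        · rw [coe_binVal_consWord, hv, e]
        · rwa [endsInZeros_consWord_iff]
  obtain ⟨w, -, hw⟩ := Real.ofDigits_SurjOn (b := 2) (by norm_num) t.2
  have hw' : binVal w = t := Subtype.ext hw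
  by_cases h : EndsInZeros w
  · obtain ⟨N, hN⟩ := h
    obtain ⟨v, hv, hv'⟩ := key N w hN (by rw [hw']; exact h0)
    exact ⟨v, by rw [← hw']; exact Subtype.ext hv, hv'⟩
  · exact ⟨w, hw', h⟩

theorem existsUnique_cantorImage (f : ThompsonF) (w : BinSeq) :
    ∃! v : BinSeq, binVal v = f • binVal w ∧ (EndsInZeros v ↔ EndsInZeros w) := by
  have hf0 := strictMono_homeomorph_zero f.1 f.2.1
  refine existsUnique_of_exists_of_unique ?_ ?_
  · by_cases h : EndsInZeros w
    · obtain ⟨v, hv, hv'⟩ := exists_endsInZeros (t := f • binVal w)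
        (f.2.2.isDyadic_apply hf0 h.isDyadic) (by
          have h1 : binVal w < 1 := h.lt_one
          have h2 : ((f.1 (binVal w) : I) : ℝ) < (f.1 1 : I) := f.2.1 h1
          exact h2.trans_le (f.1 1).2.2)
      exact ⟨v, hv, by simp [h, hv']⟩
    · have h0 : (0 : I) < binVal w := by
        refine lt_of_le_of_ne unitInterval.nonneg' fun h0 => h ⟨0, fun n _ => ?_⟩
        exact binVal_eq_zero (by rw [← h0]; rfl) n
      obtain ⟨v, hv, hv'⟩ := exists_not_endsInZeros (t := f • binVal w) (by
        have := f.2.1 h0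
        rw [hf0] at this
        exact this)
      exact ⟨v, hv, by simp [h, hv']⟩
  · rintro v v' ⟨h1, h2⟩ ⟨h3, h4⟩
    exact binVal_eq_of_endsInZeros (h1.trans h3.symm) (h2.trans h4.symm)

/-- The standard action of `F` on the Cantor set, induced by the action on `[0, 1]` through binary
expansions: `f • w` is the binary expansion of `f (0.w)`, where of the two expansions of a dyadic
rational in `(0, 1)` the one ending in `000…` is chosen if and only if `w` ends in `000…`. -/
instance standardAction : MulAction ThompsonF BinSeq where
  smul f w := (existsUnique_cantorImage f w).choose
  one_smul w := ((existsUnique_cantorImage 1 w).choose_spec.2 w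
    ⟨(one_smul ThompsonF (binVal w)).symm, Iff.rfl⟩).symm
  mul_smul f g w := by
    have h1 := (existsUnique_cantorImage g w).choose_spec.1
    have h2 := (existsUnique_cantorImage f (existsUnique_cantorImage g w).choose).choose_spec.1
    exact ((existsUnique_cantorImage (f * g) w).choose_spec.2 _
      ⟨h2.1.trans (congrArg (f • ·) h1.1), h2.2.trans h1.2⟩).symm

theorem cantor_smul_spec (f : ThompsonF) (w : BinSeq) :
    binVal (f • w) = f • binVal w ∧ (EndsInZeros (f • w) ↔ EndsInZeros w) :=
  (existsUnique_cantorImage f w).choose_spec.1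

theorem cantor_smul_eq_of {f : ThompsonF} {w v : BinSeq} (h : binVal v = f • binVal w)
    (h' : EndsInZeros v ↔ EndsInZeros w) : f • w = v :=
  ((existsUnique_cantorImage f w).choose_spec.2 v ⟨h, h'⟩).symm

/-- The generator `x₀` acts by `0w ↦ 00w`, `10w ↦ 01w`, `11w ↦ 1w`. -/
theorem x₀_smul_word (w : BinSeq) :
    x₀ • consWord 0 w = consWord 0 (consWord 0 w) ∧
    x₀ • consWord 1 (consWord 0 w) = consWord 0 (consWord 1 w) ∧
    x₀ • consWord 1 (consWord 1 w) = consWord 1 w := by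
  have h0 := (binVal w).2.1
  have h1 := (binVal w).2.2
  refine ⟨?_, ?_, ?_⟩ <;>
  · refine cantor_smul_eq_of (Subtype.ext ?_) (by simp only [endsInZeros_consWord_iff])
    rw [coe_x₀_smul]
    simp only [coe_binVal_consWord, x₀Fun, Fin.val_zero, Fin.val_one, Nat.cast_zero, Nat.cast_one]
    split_ifs <;> linarith

/-- The generator `x₁` acts by `0w ↦ 0w`, `10w ↦ 100w`, `110w ↦ 101w`, `111w ↦ 11w`. -/
theorem x₁_smul_word (w : BinSeq) :
    x₁ • consWord 0 w = consWord 0 w ∧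
    x₁ • consWord 1 (consWord 0 w) = consWord 1 (consWord 0 (consWord 0 w)) ∧
    x₁ • consWord 1 (consWord 1 (consWord 0 w)) = consWord 1 (consWord 0 (consWord 1 w)) ∧
    x₁ • consWord 1 (consWord 1 (consWord 1 w)) = consWord 1 (consWord 1 w) := by
  have h0 := (binVal w).2.1
  have h1 := (binVal w).2.2
  refine ⟨?_, ?_, ?_, ?_⟩ <;>
  · refine cantor_smul_eq_of (Subtype.ext ?_) (by simp only [endsInZeros_consWord_iff])
    rw [coe_x₁_smul]
    simp only [coe_binVal_consWord, x₁Fun, Fin.val_zero, Fin.val_one, Nat.cast_zero, Nat.cast_one]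
    split_ifs <;> linarith

/-! ### The space of pointed marked graphs -/

/-- A regular marked pointed graph with labels in `S`: every vertex has, for every label `s`,
exactly one outgoing and exactly one incoming arrow labeled by `s`. There is an arrow labeled by
`s` from `u` to `v` if and only if `step s u = v`. -/
structure MarkedGraph (S : Type) where
  V : Type
  step : S → Equiv.Perm V
  base : V

namespace MarkedGraph

variable {S : Type}

/-- The vertices at distance at most `n` from the base vertex (arrows may be traversed in both
directions). -/
def ball (Γ : MarkedGraph S) : ℕ → Set Γ.V
  | 0 => {Γ.base}
  | n + 1 => {v | v ∈ ball Γ n ∨ ∃ u ∈ ball Γ n, ∃ s, Γ.step s u = v ∨ Γ.step s v = u}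

/-- The connected component of the base vertex. -/
def component (Γ : MarkedGraph S) : Set Γ.V := ⋃ n, Γ.ball n

/-- The subgraphs induced on `A` and `B` are isomorphic as marked pointed graphs. -/
def InducedIso (Γ Δ : MarkedGraph S) (A : Set Γ.V) (B : Set Δ.V) : Prop :=
  ∃ e : A ≃ B, (∀ a : A, (a : Γ.V) = Γ.base ↔ (e a : Δ.V) = Δ.base) ∧
    ∀ (s : S) (a b : A), Γ.step s a = b ↔ Δ.step s (e a) = e b

theorem InducedIso.refl (Γ : MarkedGraph S) (A : Set Γ.V) : InducedIso Γ Γ A A :=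
  ⟨Equiv.refl _, fun _ => Iff.rfl, fun _ _ _ => Iff.rfl⟩

theorem InducedIso.symm {Γ Δ : MarkedGraph S} {A : Set Γ.V} {B : Set Δ.V}
    (h : InducedIso Γ Δ A B) : InducedIso Δ Γ B A := by
  obtain ⟨e, h1, h2⟩ := h
  exact ⟨e.symm, fun a => by simpa using (h1 (e.symm a)).symm,
    fun s a b => by simpa using (h2 s (e.symm a) (e.symm b)).symm⟩

theorem InducedIso.trans {Γ Δ Θ : MarkedGraph S} {A : Set Γ.V} {B : Set Δ.V} {C : Set Θ.V}
    (h : InducedIso Γ Δ A B) (h' : InducedIso Δ Θ B C) : InducedIso Γ Θ A C := by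
  obtain ⟨e, h1, h2⟩ := h
  obtain ⟨e', h1', h2'⟩ := h'
  exact ⟨e.trans e', fun a => (h1 a).trans (h1' (e a)),
    fun s a b => (h2 s a b).trans (h2' s (e a) (e b))⟩

/-- The balls of radius `n` around the base vertices are isomorphic as marked pointed graphs. -/
def BallIso (n : ℕ) (Γ Δ : MarkedGraph S) : Prop := InducedIso Γ Δ (Γ.ball n) (Δ.ball n)

theorem ball_subset_succ (Γ : MarkedGraph S) (n : ℕ) : Γ.ball n ⊆ Γ.ball (n + 1) :=
  fun _ h => Or.inl h

theorem ball_mono (Γ : MarkedGraph S) : Monotone Γ.ball :=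
  monotone_nat_of_le_succ Γ.ball_subset_succ

theorem base_mem_ball (Γ : MarkedGraph S) (n : ℕ) : Γ.base ∈ Γ.ball n :=
  Γ.ball_mono (Nat.zero_le n) rfl

theorem BallIso.mono {m n : ℕ} (hmn : m ≤ n) {Γ Δ : MarkedGraph S} (h : BallIso n Γ Δ) :
    BallIso m Γ Δ := by
  have fwd : ∀ {Γ Δ : MarkedGraph S} (e : Γ.ball n ≃ Δ.ball n),
      (∀ a : Γ.ball n, (a : Γ.V) = Γ.base ↔ (e a : Δ.V) = Δ.base) →
      (∀ (s : S) (a b : Γ.ball n), Γ.step s a = b ↔ Δ.step s (e a) = e b) →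
      ∀ k ≤ n, ∀ a : Γ.ball n, (a : Γ.V) ∈ Γ.ball k → (e a : Δ.V) ∈ Δ.ball k := by
    intro Γ Δ e h1 h2 k
    induction k with
    | zero => intro _ a ha; exact (h1 a).mp ha
    | succ k ih =>
      rintro hk a (ha | ⟨u, hu, s, hs⟩)
      · exact Or.inl (ih (by omega) a ha)
      · have hu' : u ∈ Γ.ball n := Γ.ball_mono (by omega) hu
        exact Or.inr ⟨e ⟨u, hu'⟩, ih (by omega) ⟨u, hu'⟩ hu, s,
          hs.imp (h2 s ⟨u, hu'⟩ a).mp (h2 s a ⟨u, hu'⟩).mp⟩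
  obtain ⟨e, h1, h2⟩ := h
  have h1' : ∀ b : Δ.ball n, (b : Δ.V) = Δ.base ↔ (e.symm b : Γ.V) = Γ.base :=
    fun b => by simpa using (h1 (e.symm b)).symm
  have h2' : ∀ (s : S) (a b : Δ.ball n),
      Δ.step s a = b ↔ Γ.step s (e.symm a) = e.symm b :=
    fun s a b => by simpa using (h2 s (e.symm a) (e.symm b)).symm
  refine ⟨⟨fun a => ⟨e ⟨a, Γ.ball_mono hmn a.2⟩, fwd e h1 h2 m hmn _ a.2⟩,
    fun b => ⟨e.symm ⟨b, Δ.ball_mono hmn b.2⟩, fwd e.symm h1' h2' m hmn _ b.2⟩,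
    fun a => ?_, fun b => ?_⟩, fun a => h1 ⟨a, Γ.ball_mono hmn a.2⟩,
    fun s a b => h2 s ⟨a, Γ.ball_mono hmn a.2⟩ ⟨b, Γ.ball_mono hmn b.2⟩⟩
  · simp
  · simp

/-- The topology of the metric `d(Γ, Δ) = 2⁻ⁿ`, where `n` is the largest integer for which the
balls of radius `n` around the base vertices are isomorphic. -/
instance : TopologicalSpace (MarkedGraph S) where
  IsOpen U := ∀ Γ ∈ U, ∃ n, ∀ Δ, BallIso n Γ Δ → Δ ∈ U
  isOpen_univ := fun _ _ => ⟨0, fun _ _ => trivial⟩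
  isOpen_inter := by
    rintro U W hU hW Γ ⟨hΓU, hΓW⟩
    obtain ⟨n, hn⟩ := hU Γ hΓU
    obtain ⟨m, hm⟩ := hW Γ hΓW
    exact ⟨max n m, fun Δ hΔ =>
      ⟨hn Δ (hΔ.mono (le_max_left _ _)), hm Δ (hΔ.mono (le_max_right _ _))⟩⟩
  isOpen_sUnion := by
    rintro 𝒰 h𝒰 Γ ⟨U, hU, hΓ⟩
    obtain ⟨n, hn⟩ := h𝒰 U hU Γ hΓ
    exact ⟨n, fun Δ hΔ => ⟨U, hU, hn Δ hΔ⟩⟩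

/-- Isomorphism of the connected components of the base vertices. -/
instance isoSetoid (S : Type) : Setoid (MarkedGraph S) where
  r Γ Δ := InducedIso Γ Δ Γ.component Δ.component
  iseqv := ⟨fun Γ => InducedIso.refl Γ _, InducedIso.symm, InducedIso.trans⟩

end MarkedGraph

/-- The space of connected regular marked pointed graphs up to isomorphism (a marked pointed graph
stands for the connected component of its base vertex), with the topology in which two graphs are
close if they have isomorphic balls of large radius centered at the base vertices. -/
abbrev GraphSpace (S : Type) : Type 1 := Quotient (MarkedGraph.isoSetoid S)

/-! ### Schreier graphs and Schreier dynamical systems -/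

/-- The Schreier graph of the action of `G` on the orbit of `y` with respect to the family `gen`
of elements of `G`, with base vertex `y`: there is an arrow labeled by `s` from `u` to
`gen s • u`. -/
def orbitalSchreierGraph {G M S : Type} [Group G] [MulAction G M] (gen : S → G) (y : M) :
    MarkedGraph S where
  V := MulAction.orbit G y
  step s := MulAction.toPerm (gen s)
  base := ⟨y, MulAction.mem_orbit_self y⟩

/-- The pointed Schreier graph `Γ_y` of a point `y` of `[0, 1]` with respect to the generators
`x₀`, `x₁` of Thompson's group `F`. -/
def schreierGraph (y : I) : GraphSpace (Fin 2) := ⟦orbitalSchreierGraph ![x₀, x₁] y⟧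

/-- The family `𝒞_x` of the pointed Schreier graphs `Γ_y` of the points `y` of the orbit of `x`. -/
def schreierFamily (x : I) : Set (GraphSpace (Fin 2)) :=
  schreierGraph '' MulAction.orbit ThompsonF x

theorem schreierGraph_mem_closure {x y : I} (hy : y ∈ MulAction.orbit ThompsonF x) :
    schreierGraph y ∈ closure (schreierFamily x) :=
  subset_closure (mem_image_of_mem _ hy)

/-- `α` is the Schreier dynamical system of the orbit of `x`: an action of `F` by homeomorphisms on
the closure of `𝒞_x` which on `𝒞_x` itself shifts the base vertex, that is, `f` takes the Schreier
graph with base vertex `y` to the same graph with base vertex `f y`. -/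
def IsSchreierSystem (x : I)
    (α : ThompsonF →* (closure (schreierFamily x) ≃ₜ closure (schreierFamily x))) : Prop :=
  ∀ (f : ThompsonF) (y : I) (hy : y ∈ MulAction.orbit ThompsonF x),
    (α f ⟨schreierGraph y, schreierGraph_mem_closure hy⟩ : GraphSpace (Fin 2)) =
      schreierGraph (f • y)

/-- The set `𝒟`: the perfect kernel of the closure of the family of pointed Schreier graphs of the
dyadic rationals in `(0, 1)` (the orbit of `1 / 2`). -/
def dyadicKernel : Set (GraphSpace (Fin 2)) :=
  CantorBendixson.perfectKernel
    (closure (schreierFamily ⟨1 / 2, by norm_num, by norm_num⟩))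

end

/-!
A graph in `𝒯` is determined by the words in `x₀^±1`, `x₁^±1` that label its closed paths at the
base vertex. They form a subgroup of the free group on two letters, and the topology of `𝒯` is
that of pointwise convergence of subgroups. Moving the base vertex along a word is a continuous
action of the free group. Since `x₀` and `x₁` generate `F`, the map `Γ_y ↦ Γ_{f y}` is the action
of any word that represents `f`.

Every element of `F` acts near an infinite binary word `w` by replacing a prefix, so near `w`
either it is the identity or it fixes no point except possibly `w`. Hence, as `v → w` with
`v ≠ w`, the stabilizer of `v` converges to the group of elements whose germ at `w` is trivial. The
graphs of these germ stabilizers depend continuously on `w`, and they are pairwise distinct: the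
germ of `x₁` at `w` is trivial exactly if `w` starts with `0`, and `F` moves two given distinct
words to words that start with different letters. So they form a Cantor set, on which moving the
base vertex is the action of `F` on words. Since the orbit of `x` is dense in the space of words,
the closure of `𝒞_x` is this Cantor set together with isolated points, whatever `x` is.
-/

/-! ### Derived sets and perfect kernels -/

section Topology

variable {X Y : Type*} [TopologicalSpace X] [TopologicalSpace Y]

theorem derivedSet_image_subset_range [CompactSpace X] [T2Space Y] {u p : X → Y}
    (h : ∀ x, Filter.Tendsto u (𝓝[≠] x) (𝓝 (p x))) (D : Set X) :
    derivedSet (u '' D) ⊆ range p := by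
  intro y hy
  have : (Filter.comap u (𝓝[≠] y)).NeBot := Filter.comap_neBot_iff_frequently.mpr <|
    (accPt_iff_frequently_nhdsNE.mp hy).mono <| image_subset_range u D
  let 𝒰 := Ultrafilter.of (Filter.comap u (𝓝[≠] y))
  have hu : Filter.Tendsto u 𝒰 (𝓝[≠] y) := Filter.tendsto_iff_comap.mpr (Ultrafilter.of_le _)
  obtain ⟨x, -, hx⟩ := isCompact_univ.ultrafilter_le_nhds 𝒰 (by simp)
  by_cases hmem : {x} ∈ 𝒰
  · have hne : ∀ᶠ z in (𝒰 : Filter X), u z = u x :=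
      Filter.mem_of_superset hmem fun z hz => congrArg u hz
    have huy : u x = y := tendsto_nhds_unique
      (tendsto_const_nhds.congr' (hne.mono fun _ hz => hz.symm))
      (hu.mono_right nhdsWithin_le_nhds)
    obtain ⟨z, hz, hzy⟩ := (hne.and (hu.eventually self_mem_nhdsWithin)).exists
    exact absurd (hz.trans huy) hzy
  · have hle : (𝒰 : Filter X) ≤ 𝓝[≠] x :=
      le_inf hx (Filter.le_principal_iff.mpr (Ultrafilter.compl_mem_iff_notMem.mpr hmem))
    exact ⟨x, tendsto_nhds_unique ((h x).mono_left hle) (hu.mono_right nhdsWithin_le_nhds)⟩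

theorem frequently_nhdsNE_of_dense [T1Space X] [PerfectSpace X] {D : Set X} (hD : Dense D) (x : X) :
    ∃ᶠ v in 𝓝[≠] x, v ∈ D := by
  rw [frequently_nhdsWithin_iff]
  exact mem_closure_iff_frequently.mp (hD.sdiff_singleton x x)

theorem perfectKernel_closure_eq [T1Space Y] {A P : Set Y} (hP : Perfect P)
    (hPA : P ⊆ closure A) (hAP : derivedSet A ⊆ P) :
    CantorBendixson.perfectKernel (closure A) = P := by
  refine Subset.antisymm (fun y hy => hAP ?_) (hP.subset_perfectKernel hPA)
  rw [← derivedSet_closure]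
  exact ((CantorBendixson.perfect_perfectKernel isClosed_closure).acc y hy).mono
    (Filter.principal_mono.mpr (CantorBendixson.perfectKernel_subset _))

theorem perfect_range_of_continuous_injective [CompactSpace X] [PerfectSpace X] [T2Space Y]
    {p : X → Y} (hp : Continuous p) (hinj : Function.Injective p) : Perfect (range p) := by
  refine ⟨(isCompact_range hp).isClosed, ?_⟩
  rintro _ ⟨x, rfl⟩
  exact image_univ ▸ Filter.map_principal ▸
    (PerfectSpace.univ_preperfect x (mem_univ x)).map hp.continuousAt hinj

end Topology

/-! ### Actions on closures -/

section ClosureAction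

variable {M Y : Type*} [Group M] [TopologicalSpace Y] [MulAction M Y] [ContinuousConstSMul M Y]
  {A : Set Y}

theorem smul_mem_closure_iff (hA : ∀ m : M, ∀ y ∈ A, m • y ∈ A) (m : M) (y : Y) :
    m • y ∈ closure A ↔ y ∈ closure A := by
  have key : ∀ (m : M), ∀ y ∈ closure A, m • y ∈ closure A := fun m y hy =>
    map_mem_closure (continuous_const_smul m) hy (hA m)
  exact ⟨fun h => inv_smul_smul m y ▸ key m⁻¹ _ h, key m y⟩

/-- The action by homeomorphisms on the closure of an invariant set. -/
def closureHom (hA : ∀ m : M, ∀ y ∈ A, m • y ∈ A) : M →* (closure A ≃ₜ closure A) where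
  toFun m := (Homeomorph.smul m).subtype fun y => (smul_mem_closure_iff hA m y).symm
  map_one' := Homeomorph.ext fun y => Subtype.ext (one_smul M (y : Y))
  map_mul' m n := Homeomorph.ext fun y => Subtype.ext (mul_smul m n (y : Y))

theorem coe_closureHom_apply (hA : ∀ m : M, ∀ y ∈ A, m • y ∈ A) (m : M) (y : closure A) :
    (closureHom hA m y : Y) = m • (y : Y) :=
  rfl

theorem exists_monoidHom_closure {G : Type*} [Group G] [T2Space Y]
    (hA : ∀ m : M, ∀ y ∈ A, m • y ∈ A) {π : M →* G} (hπ : Function.Surjective π)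
    (hker : ∀ m ∈ π.ker, ∀ y ∈ A, m • y = y) :
    ∃ α : G →* (closure A ≃ₜ closure A), ∀ m (y : closure A), (α (π m) y : Y) = m • (y : Y) := by
  have hle : π.ker ≤ (closureHom hA).ker := fun m hm => Homeomorph.ext fun y => Subtype.ext <|
    EqOn.closure (hker m hm) (continuous_const_smul m) continuous_id y.2
  refine ⟨π.liftOfSurjective hπ ⟨closureHom hA, hle⟩, fun m y => ?_⟩
  rw [MonoidHom.liftOfRightInverse_comp_apply, coe_closureHom_apply]

end ClosureAction

/-! ### Marked graphs and their loop groups -/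

open Classical in
/-- The indicator function of a subgroup; it gives the set of subgroups the topology of pointwise
convergence. -/
noncomputable def subgroupIndicator {G : Type*} [Group G] (H : Subgroup G) (g : G) : Bool :=
  decide (g ∈ H)

theorem subgroupIndicator_eq_iff {G : Type*} [Group G] {H K : Subgroup G} {g : G} :
    subgroupIndicator H g = subgroupIndicator K g ↔ (g ∈ H ↔ g ∈ K) := by
  simp only [subgroupIndicator, decide_eq_decide]

theorem subgroupIndicator_injective {G : Type*} [Group G] :
    Function.Injective (subgroupIndicator (G := G)) := fun _ _ h =>
  Subgroup.ext fun g => subgroupIndicator_eq_iff.mp (congrFun h g)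

namespace MarkedGraph

open scoped Pointwise

variable {S : Type} {Γ Δ : MarkedGraph S}

/-- The action of words on the vertices of a marked graph: a word moves a vertex along the path
that it labels. -/
def wordPerm (Γ : MarkedGraph S) : FreeGroup S →* Equiv.Perm Γ.V := FreeGroup.lift Γ.step

theorem wordPerm_of_mul (Γ : MarkedGraph S) (s : S) (g : FreeGroup S) (v : Γ.V) :
    Γ.wordPerm (FreeGroup.of s * g) v = Γ.step s (Γ.wordPerm g v) := by
  simp only [wordPerm, map_mul, FreeGroup.lift_apply_of, Equiv.Perm.mul_apply]

/-- The group of words that label closed paths at the base vertex. -/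
def loopGroup (Γ : MarkedGraph S) : Subgroup (FreeGroup S) :=
  (MulAction.stabilizer (Equiv.Perm Γ.V) Γ.base).comap Γ.wordPerm

theorem mem_loopGroup {g : FreeGroup S} : g ∈ Γ.loopGroup ↔ Γ.wordPerm g Γ.base = Γ.base :=
  Iff.rfl

theorem inv_mul_mem_loopGroup_iff {g h : FreeGroup S} :
    h⁻¹ * g ∈ Γ.loopGroup ↔ Γ.wordPerm g Γ.base = Γ.wordPerm h Γ.base := by
  rw [mem_loopGroup, map_mul, map_inv, Equiv.Perm.mul_apply, Equiv.Perm.inv_eq_iff_eq]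

/-- The words of length at most one. -/
def letters (S : Type) : Set (FreeGroup S) :=
  insert 1 (range FreeGroup.of ∪ (range FreeGroup.of)⁻¹)

theorem one_mem_letters : (1 : FreeGroup S) ∈ letters S := mem_insert _ _

theorem of_mem_letters (s : S) : FreeGroup.of s ∈ letters S := Or.inr (Or.inl ⟨s, rfl⟩)

theorem inv_of_mem_letters (s : S) : (FreeGroup.of s)⁻¹ ∈ letters S :=
  Or.inr (Or.inr ⟨s, (inv_inv _).symm⟩)

theorem finite_letters [Finite S] : (letters S).Finite :=
  ((finite_range _).union (finite_range _).inv).insert 1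

theorem finite_letters_pow [Finite S] (n : ℕ) : (letters S ^ n).Finite := by
  induction n with
  | zero => exact finite_one
  | succ n ih => exact pow_succ (letters S) n ▸ ih.mul finite_letters

theorem mem_letters_pow_succ {g : FreeGroup S} {n : ℕ} :
    g ∈ letters S ^ (n + 1) ↔ g ∈ letters S ^ n ∨
      ∃ h ∈ letters S ^ n, ∃ s, FreeGroup.of s * h = g ∨ FreeGroup.of s * g = h := by
  rw [pow_succ', mem_mul]
  constructor
  · rintro ⟨_, rfl | ⟨s, rfl⟩ | ⟨s, hs⟩, h, hh, rfl⟩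
    · exact Or.inl (by rwa [one_mul])
    · exact Or.inr ⟨h, hh, s, Or.inl rfl⟩
    · exact Or.inr ⟨h, hh, s, Or.inr (hs ▸ inv_mul_cancel_left _ _)⟩
  · rintro (hg | ⟨h, hh, s, rfl | rfl⟩)
    · exact ⟨1, one_mem_letters, g, hg, one_mul g⟩
    · exact ⟨_, of_mem_letters s, h, hh, rfl⟩
    · exact ⟨_, inv_of_mem_letters s, _, hh, inv_mul_cancel_left _ _⟩

theorem exists_mem_letters_pow (g : FreeGroup S) : ∃ n, g ∈ letters S ^ n := by
  induction g using FreeGroup.induction_on with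
  | C1 => exact ⟨0, rfl⟩
  | of s => exact ⟨1, by simpa only [pow_one] using of_mem_letters s⟩
  | inv_of s _ => exact ⟨1, by simpa only [pow_one] using inv_of_mem_letters s⟩
  | mul g h hg hh =>
    obtain ⟨m, hm⟩ := hg
    obtain ⟨n, hn⟩ := hh
    exact ⟨m + n, pow_add (letters S) m n ▸ mul_mem_mul hm hn⟩

/-- The vertices reached from the base vertex along the words of `W`. -/
def reach (Γ : MarkedGraph S) (W : Set (FreeGroup S)) : Set Γ.V :=
  (fun g => Γ.wordPerm g Γ.base) '' W

theorem ball_eq_reach (Γ : MarkedGraph S) (n : ℕ) : Γ.ball n = Γ.reach (letters S ^ n) := by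
  induction n with
  | zero => simp [ball, reach]
  | succ n ih =>
    ext v
    simp only [ball, ih, reach, mem_ofPred_eq, mem_image, mem_letters_pow_succ]
    constructor
    · rintro (⟨g, hg, rfl⟩ | ⟨_, ⟨g, hg, rfl⟩, s, rfl | hs⟩)
      · exact ⟨g, Or.inl hg, rfl⟩
      · exact ⟨_, Or.inr ⟨g, hg, s, Or.inl rfl⟩, Γ.wordPerm_of_mul s g _⟩
      · refine ⟨(FreeGroup.of s)⁻¹ * g, Or.inr ⟨g, hg, s, Or.inr (mul_inv_cancel_left _ _)⟩, ?_⟩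
        rw [← (Γ.step s).injective.eq_iff, ← wordPerm_of_mul, mul_inv_cancel_left, hs]
    · rintro ⟨g, hg | ⟨h, hh, s, rfl | rfl⟩, rfl⟩
      · exact Or.inl ⟨g, hg, rfl⟩
      · exact Or.inr ⟨_, ⟨h, hh, rfl⟩, s, Or.inl (Γ.wordPerm_of_mul s h _).symm⟩
      · exact Or.inr ⟨_, ⟨_, hh, rfl⟩, s, Or.inr (Γ.wordPerm_of_mul s g _).symm⟩

theorem component_eq_reach (Γ : MarkedGraph S) : Γ.component = Γ.reach univ := by
  simp only [component, ball_eq_reach, reach, ← image_iUnion]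
  exact congrArg _ (eq_univ_of_forall fun g => mem_iUnion.mpr (exists_mem_letters_pow g))

theorem inducedIso_reach {W : Set (FreeGroup S)} (h1 : 1 ∈ W)
    (hW : ∀ t ∈ letters S, ∀ g ∈ W, ∀ h ∈ W,
      h⁻¹ * (t * g) ∈ Γ.loopGroup ↔ h⁻¹ * (t * g) ∈ Δ.loopGroup) :
    InducedIso Γ Δ (Γ.reach W) (Δ.reach W) := by
  simp only [inv_mul_mem_loopGroup_iff] at hW
  have heq : ∀ g ∈ W, ∀ h ∈ W, Γ.wordPerm g Γ.base = Γ.wordPerm h Γ.base ↔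
      Δ.wordPerm g Δ.base = Δ.wordPerm h Δ.base := fun g hg h hh => by
    simpa only [one_mul] using hW 1 one_mem_letters g hg h hh
  choose w hw hwa using show ∀ a : Γ.reach W, ∃ g ∈ W, Γ.wordPerm g Γ.base = a from fun a => a.2
  let e : Γ.reach W → Δ.reach W := fun a => ⟨Δ.wordPerm (w a) Δ.base, w a, hw a, rfl⟩
  have he : Function.Bijective e := by
    constructor
    · intro a b hab
      have := (heq _ (hw a) _ (hw b)).mpr (congrArg Subtype.val hab)
      exact Subtype.ext (by rwa [hwa, hwa] at this)
    · rintro ⟨_, g, hg, rfl⟩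
      exact ⟨⟨Γ.wordPerm g Γ.base, g, hg, rfl⟩, Subtype.ext ((heq _ (hw _) _ hg).mp (hwa _))⟩
  refine ⟨Equiv.ofBijective e he, fun a => ?_, fun s a b => ?_⟩
  · have := heq _ (hw a) 1 h1
    rwa [hwa, map_one, map_one] at this
  · have := hW _ (of_mem_letters s) _ (hw a) _ (hw b)
    rwa [wordPerm_of_mul, wordPerm_of_mul, hwa, hwa] at this

theorem InducedIso.exists_apply_wordPerm_eq {A : Set Γ.V} {B : Set Δ.V} {e : A ≃ B}
    (hbase : ∀ a : A, (a : Γ.V) = Γ.base ↔ (e a : Δ.V) = Δ.base)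
    (hstep : ∀ (s : S) (a b : A), Γ.step s a = b ↔ Δ.step s (e a) = e b) {n : ℕ}
    (hn : Γ.ball n ⊆ A) {g : FreeGroup S} (hg : g ∈ letters S ^ n) :
    ∃ ha : Γ.wordPerm g Γ.base ∈ A, (e ⟨_, ha⟩ : Δ.V) = Δ.wordPerm g Δ.base := by
  induction n generalizing g with
  | zero =>
    obtain rfl : g = 1 := hg
    exact ⟨hn rfl, (hbase ⟨_, hn rfl⟩).mp rfl⟩
  | succ n ih =>
    have hmem : Γ.wordPerm g Γ.base ∈ A := hn (Γ.ball_eq_reach _ ▸ ⟨g, hg, rfl⟩)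
    replace ih := @ih ((Γ.ball_subset_succ n).trans hn)
    refine ⟨hmem, ?_⟩
    rcases mem_letters_pow_succ.mp hg with hg | ⟨h, hh, s, rfl | rfl⟩
    · exact (ih hg).2
    · obtain ⟨ha, hea⟩ := ih hh
      rw [Δ.wordPerm_of_mul, ← hea]
      exact ((hstep s ⟨_, ha⟩ ⟨_, hmem⟩).mp (Γ.wordPerm_of_mul s h _).symm).symm
    · obtain ⟨ha, hea⟩ := ih hh
      rw [← (Δ.step s).injective.eq_iff, ← wordPerm_of_mul, ← hea]
      exact (hstep s ⟨_, hmem⟩ ⟨_, ha⟩).mp (Γ.wordPerm_of_mul s g _).symm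

theorem InducedIso.mem_loopGroup_iff {A : Set Γ.V} {B : Set Δ.V} (h : InducedIso Γ Δ A B) {n : ℕ}
    (hn : Γ.ball n ⊆ A) {g : FreeGroup S} (hg : g ∈ letters S ^ n) :
    g ∈ Γ.loopGroup ↔ g ∈ Δ.loopGroup := by
  obtain ⟨e, hbase, hstep⟩ := h
  obtain ⟨ha, hea⟩ := InducedIso.exists_apply_wordPerm_eq hbase hstep hn hg
  rw [mem_loopGroup, mem_loopGroup, ← hea]
  exact hbase ⟨_, ha⟩

theorem equiv_iff_loopGroup_eq : Γ ≈ Δ ↔ Γ.loopGroup = Δ.loopGroup := by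
  constructor
  · intro h
    ext g
    obtain ⟨n, hn⟩ := exists_mem_letters_pow g
    exact InducedIso.mem_loopGroup_iff h (subset_iUnion _ n) hn
  · intro h
    change InducedIso Γ Δ Γ.component Δ.component
    rw [component_eq_reach, component_eq_reach]
    exact inducedIso_reach trivial fun _ _ _ _ _ _ => h ▸ Iff.rfl

theorem isInducing_loopGroup [Finite S] :
    IsInducing fun Γ : MarkedGraph S => subgroupIndicator Γ.loopGroup := by
  refine isInducing_iff_nhds.mpr fun Γ => le_antisymm ?_ fun U hU => ?_
  · refine Filter.map_le_iff_le_comap.mp (tendsto_pi_nhds.mpr fun g => ?_)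
    obtain ⟨n, hn⟩ := exists_mem_letters_pow g
    have hopen : IsOpen {Δ | BallIso n Γ Δ} := fun Δ hΔ => ⟨n, fun _ h => InducedIso.trans hΔ h⟩
    refine tendsto_const_nhds.congr' ?_
    filter_upwards [hopen.mem_nhds (InducedIso.refl Γ _)] with Δ hΔ
    exact subgroupIndicator_eq_iff.mpr (InducedIso.mem_loopGroup_iff hΔ subset_rfl hn)
  · obtain ⟨V, hVU, hV, hΓV⟩ := mem_nhds_iff.mp hU
    obtain ⟨n, hn⟩ := hV Γ hΓV
    have hfin := finite_letters_pow (S := S) n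
    refine Filter.mem_of_superset (Filter.preimage_mem_comap
      (set_pi_mem_nhds (hfin.inv.mul (finite_letters.mul hfin))
        fun g _ => mem_nhds_discrete.mpr (mem_singleton (subgroupIndicator Γ.loopGroup g))))
      fun Δ hΔ => hVU (hn Δ ?_)
    rw [BallIso, ball_eq_reach, ball_eq_reach]
    refine inducedIso_reach (one_mem_pow one_mem_letters) fun t ht g hg h hh => ?_
    exact (subgroupIndicator_eq_iff.mp <| hΔ _ <|
      mul_mem_mul (Set.inv_mem_inv.mpr hh) (mul_mem_mul ht hg)).symm

/-- The graph with the base vertex moved along a word. -/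
def shift (g : FreeGroup S) (Γ : MarkedGraph S) : MarkedGraph S where
  V := Γ.V
  step := Γ.step
  base := Γ.wordPerm g Γ.base

theorem mem_loopGroup_shift {g h : FreeGroup S} :
    h ∈ (Γ.shift g).loopGroup ↔ g⁻¹ * h * g ∈ Γ.loopGroup := by
  rw [mul_assoc, inv_mul_mem_loopGroup_iff, map_mul]
  rfl

theorem loopGroup_orbitalSchreierGraph {G M : Type} [Group G] [MulAction G M] (gen : S → G)
    (y : M) : (orbitalSchreierGraph gen y).loopGroup =
      (MulAction.stabilizer G y).comap (FreeGroup.lift gen) := by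
  have key : (orbitalSchreierGraph gen y).wordPerm =
      (MulAction.toPermHom G (MulAction.orbit G y)).comp (FreeGroup.lift gen) :=
    FreeGroup.ext_hom _ _ fun s =>
      FreeGroup.lift_apply_of.trans (congrArg MulAction.toPerm FreeGroup.lift_apply_of.symm)
  ext g
  rw [mem_loopGroup, key]
  exact Subtype.ext_iff

end MarkedGraph

namespace GraphSpace

variable {S : Type}

/-- The group of words that label closed paths at the base vertex. -/
def loopGroup (Γ : GraphSpace S) : Subgroup (FreeGroup S) :=
  Quotient.lift MarkedGraph.loopGroup (fun _ _ => MarkedGraph.equiv_iff_loopGroup_eq.mp) Γ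

theorem loopGroup_injective : Function.Injective (loopGroup : GraphSpace S → _) := by
  rintro ⟨Γ⟩ ⟨Δ⟩ h
  exact Quotient.sound (MarkedGraph.equiv_iff_loopGroup_eq.mpr h)

theorem loopGroup_mk_orbitalSchreierGraph {G M : Type} [Group G] [MulAction G M] (gen : S → G)
    (y : M) : loopGroup ⟦orbitalSchreierGraph gen y⟧ =
      (MulAction.stabilizer G y).comap (FreeGroup.lift gen) :=
  MarkedGraph.loopGroup_orbitalSchreierGraph gen y

theorem isEmbedding_loopGroup [Finite S] :
    IsEmbedding fun Γ : GraphSpace S => subgroupIndicator Γ.loopGroup :=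
  isEmbedding_of_isOpenQuotientMap_of_isInducing _ _ _ id rfl MarkedGraph.isInducing_loopGroup
    isQuotientMap_quotient_mk' .id (subgroupIndicator_injective.comp loopGroup_injective) (by simp)

instance [Finite S] : T2Space (GraphSpace S) := isEmbedding_loopGroup.t2Space

theorem tendsto_nhds_iff [Finite S] {X : Type*} {l : Filter X} {u : X → GraphSpace S}
    {Γ : GraphSpace S} : Filter.Tendsto u l (𝓝 Γ) ↔
      ∀ g, ∀ᶠ i in l, (g ∈ (u i).loopGroup ↔ g ∈ Γ.loopGroup) := by
  simp only [isEmbedding_loopGroup.tendsto_nhds_iff, tendsto_pi_nhds, nhds_discrete,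
    Filter.tendsto_pure, Function.comp_apply, subgroupIndicator_eq_iff]

/-- Words act on marked graphs by moving the base vertex. -/
instance : MulAction (FreeGroup S) (GraphSpace S) where
  smul g := Quotient.map (MarkedGraph.shift g) fun Γ Δ h => by
    simp only [MarkedGraph.equiv_iff_loopGroup_eq, Subgroup.ext_iff,
      MarkedGraph.mem_loopGroup_shift] at h ⊢
    exact fun k => h _
  one_smul := by
    rintro ⟨Γ⟩
    exact Quotient.sound <| MarkedGraph.equiv_iff_loopGroup_eq.mpr <| Subgroup.ext fun k => by
      simp only [MarkedGraph.mem_loopGroup_shift, inv_one, one_mul, mul_one]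
  mul_smul g h := by
    rintro ⟨Γ⟩
    exact Quotient.sound <| MarkedGraph.equiv_iff_loopGroup_eq.mpr <| Subgroup.ext fun k => by
      simp only [MarkedGraph.mem_loopGroup_shift, mul_inv_rev, mul_assoc]

theorem mem_loopGroup_smul {g h : FreeGroup S} {Γ : GraphSpace S} :
    h ∈ (g • Γ).loopGroup ↔ g⁻¹ * h * g ∈ Γ.loopGroup := by
  rcases Γ with ⟨Γ⟩
  exact MarkedGraph.mem_loopGroup_shift

instance [Finite S] : ContinuousConstSMul (FreeGroup S) (GraphSpace S) where
  continuous_const_smul g := continuous_iff_continuousAt.mpr fun Γ => by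
    refine tendsto_nhds_iff.mpr fun h => ?_
    simp only [mem_loopGroup_smul]
    exact tendsto_nhds_iff.mp Filter.tendsto_id _

theorem smul_mk_orbitalSchreierGraph {G M : Type} [Group G] [MulAction G M] (gen : S → G)
    (g : FreeGroup S) (y : M) : g • (⟦orbitalSchreierGraph gen y⟧ : GraphSpace S) =
      ⟦orbitalSchreierGraph gen (FreeGroup.lift gen g • y)⟧ := by
  refine loopGroup_injective (Subgroup.ext fun h => ?_)
  simp only [mem_loopGroup_smul, loopGroup_mk_orbitalSchreierGraph, Subgroup.mem_comap, map_mul,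
    map_inv, MulAction.mem_stabilizer_iff, mul_smul, inv_smul_eq_iff]

end GraphSpace

/-! ### Germ stabilizers -/

section Germs

variable (G : Type*) {X : Type*} [Group G] [TopologicalSpace X] [MulAction G X]

/-- The group of the elements that act as the identity near `x`, that is, whose germ at `x` is
trivial. -/
def germStabilizer (x : X) : Subgroup G where
  carrier := {g | ∀ᶠ y in 𝓝 x, g • y = y}
  one_mem' := Filter.Eventually.of_forall (one_smul G)
  mul_mem' hf hg := by
    filter_upwards [hf, hg] with y hfy hgy
    rw [mul_smul, hgy, hfy]
  inv_mem' hg := by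
    filter_upwards [hg] with y hy
    rw [inv_smul_eq_iff, hy]

variable {G}

theorem mem_germStabilizer {g : G} {x : X} :
    g ∈ germStabilizer G x ↔ ∀ᶠ y in 𝓝 x, g • y = y :=
  Iff.rfl

theorem smul_eq_of_mem_germStabilizer {g : G} {x : X} (hg : g ∈ germStabilizer G x) :
    g • x = x :=
  (mem_germStabilizer.mp hg).self_of_nhds

theorem mem_germStabilizer_smul_iff [ContinuousConstSMul G X] {f g : G} {x : X} :
    g ∈ germStabilizer G (f • x) ↔ f⁻¹ * g * f ∈ germStabilizer G x := by
  rw [mem_germStabilizer, ← Homeomorph.smul_apply, ← (Homeomorph.smul f).map_nhds_eq,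
    Filter.eventually_map, mem_germStabilizer]
  simp only [Homeomorph.smul_apply, mul_smul, inv_smul_eq_iff]

variable (G X) in
/-- Every point fixed by `g : G` is either interior to the set of fixed points of `g` or isolated
in it. -/
class IsolatesFixedPoints : Prop where
  eventually_smul_eq_or_ne (g : G) (x : X) :
    (∀ᶠ y in 𝓝 x, g • y = y) ∨ ∀ᶠ y in 𝓝[≠] x, g • y ≠ y

variable [IsolatesFixedPoints G X]

theorem eventually_nhdsNE_smul_eq_iff (g : G) (x : X) :
    ∀ᶠ y in 𝓝[≠] x, (g • y = y ↔ g ∈ germStabilizer G x) := by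
  by_cases hg : g ∈ germStabilizer G x
  · filter_upwards [nhdsWithin_le_nhds hg] with y hy
    exact iff_of_true hy hg
  · filter_upwards [(IsolatesFixedPoints.eventually_smul_eq_or_ne g x).resolve_left hg] with y hy
    exact iff_of_false hy hg

theorem eventually_mem_germStabilizer_iff (g : G) (x : X) :
    ∀ᶠ y in 𝓝 x, (g ∈ germStabilizer G y ↔ g ∈ germStabilizer G x) := by
  by_cases hg : g ∈ germStabilizer G x
  · filter_upwards [eventually_eventually_nhds.mpr hg] with y hy
    exact iff_of_true hy hg
  · filter_upwards [eventually_nhdsWithin_iff.mp (eventually_nhdsNE_smul_eq_iff g x)] with y hy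
    refine iff_of_false (fun hgy => ?_) hg
    rcases eq_or_ne y x with rfl | hne
    · exact hg hgy
    · exact hg ((hy hne).mp (smul_eq_of_mem_germStabilizer hgy))

end Germs

/-! ### Schreier graphs of points and of germs -/

section SchreierDynamics

variable {S G X : Type} [Group G] [MulAction G X] (gen : S → G)

/-- The Schreier graph of the point `x`, as a point of the space of marked graphs. -/
def pointGraph (x : X) : GraphSpace S := ⟦orbitalSchreierGraph gen x⟧

theorem mem_loopGroup_pointGraph {x : X} {g : FreeGroup S} :
    g ∈ (pointGraph gen x).loopGroup ↔ FreeGroup.lift gen g • x = x := by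
  rw [pointGraph, GraphSpace.loopGroup_mk_orbitalSchreierGraph]
  rfl

theorem smul_pointGraph (g : FreeGroup S) (x : X) :
    g • pointGraph gen x = pointGraph gen (FreeGroup.lift gen g • x) :=
  GraphSpace.smul_mk_orbitalSchreierGraph gen g x

variable [TopologicalSpace X]

/-- The Schreier graph of the germ at `x`: the graph of the cosets of the germ stabilizer. -/
def germGraph (x : X) : GraphSpace S :=
  ⟦orbitalSchreierGraph gen ((1 : G) : G ⧸ germStabilizer G x)⟧

theorem mem_loopGroup_germGraph {x : X} {g : FreeGroup S} :
    g ∈ (germGraph gen x).loopGroup ↔ FreeGroup.lift gen g ∈ germStabilizer G x := by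
  rw [germGraph, GraphSpace.loopGroup_mk_orbitalSchreierGraph, MulAction.stabilizer_quotient,
    Subgroup.mem_comap]

theorem smul_germGraph [ContinuousConstSMul G X] (g : FreeGroup S) (x : X) :
    g • germGraph gen x = germGraph gen (FreeGroup.lift gen g • x) := by
  refine GraphSpace.loopGroup_injective (Subgroup.ext fun h => ?_)
  simp only [GraphSpace.mem_loopGroup_smul, mem_loopGroup_germGraph, mem_germStabilizer_smul_iff,
    map_mul, map_inv]

variable {gen}

theorem germGraph_injective (hgen : Function.Surjective (FreeGroup.lift gen))
    (hinj : Function.Injective (germStabilizer G : X → Subgroup G)) :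
    Function.Injective (germGraph gen : X → GraphSpace S) := fun x y h => by
  refine hinj (Subgroup.comap_injective hgen (Subgroup.ext fun g => ?_))
  rw [Subgroup.mem_comap, Subgroup.mem_comap, ← mem_loopGroup_germGraph, h,
    mem_loopGroup_germGraph]

variable [Finite S] [IsolatesFixedPoints G X]

theorem tendsto_pointGraph (x : X) :
    Filter.Tendsto (pointGraph gen) (𝓝[≠] x) (𝓝 (germGraph gen x)) := by
  simp only [GraphSpace.tendsto_nhds_iff, mem_loopGroup_pointGraph, mem_loopGroup_germGraph]
  exact fun g => eventually_nhdsNE_smul_eq_iff _ x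

theorem continuous_germGraph : Continuous (germGraph gen : X → GraphSpace S) := by
  refine continuous_iff_continuousAt.mpr fun x => GraphSpace.tendsto_nhds_iff.mpr fun g => ?_
  simp only [mem_loopGroup_germGraph]
  exact eventually_mem_germStabilizer_iff _ x

theorem perfectKernel_closure_image_pointGraph [CompactSpace X] [T1Space X] [PerfectSpace X]
    (hinj : Function.Injective (germGraph gen : X → GraphSpace S)) {D : Set X} (hD : Dense D) :
    CantorBendixson.perfectKernel (closure (pointGraph gen '' D)) =
      range (germGraph gen : X → GraphSpace S) := by
  refine perfectKernel_closure_eq (perfect_range_of_continuous_injective continuous_germGraph hinj)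
    ?_ (derivedSet_image_subset_range tendsto_pointGraph D)
  rintro _ ⟨x, rfl⟩
  exact mem_closure_of_frequently_of_tendsto
    ((frequently_nhdsNE_of_dense hD x).mono fun _ => mem_image_of_mem _) (tendsto_pointGraph x)

end SchreierDynamics

/-! ### Finite prefixes of infinite words -/

section Words

variable {α : Type*}

/-- The infinite word `uw`. -/
def prepend : List α → (ℕ → α) → ℕ → α
  | [], w, n => w n
  | a :: _, _, 0 => a
  | _ :: u, w, n + 1 => prepend u w n

@[simp]
theorem prepend_nil (w : ℕ → α) : prepend [] w = w := rfl

@[simp]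
theorem prepend_cons_zero (a : α) (u : List α) (w : ℕ → α) : prepend (a :: u) w 0 = a := rfl

theorem prepend_append (u v : List α) (w : ℕ → α) :
    prepend (u ++ v) w = prepend u (prepend v w) := by
  induction u with
  | nil => rfl
  | cons a u ih =>
    funext n
    cases n with
    | zero => rfl
    | succ n => exact congrFun ih n

theorem prepend_cons_eq_prepend_cons {a b : α} {u v : List α} {w z : ℕ → α} :
    prepend (a :: u) w = prepend (b :: v) z ↔ a = b ∧ prepend u w = prepend v z := by
  refine ⟨fun h => ⟨congrFun h 0, funext fun n => congrFun h (n + 1)⟩, ?_⟩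
  rintro ⟨rfl, h⟩
  exact funext fun n => Nat.casesOn n rfl (congrFun h)

theorem prepend_injective (u : List α) : Function.Injective (prepend u) := by
  induction u with
  | nil => exact fun _ _ h => h
  | cons a u ih => exact fun _ _ h => ih (prepend_cons_eq_prepend_cons.mp h).2

theorem exists_eq_prepend (n : ℕ) (w : ℕ → α) : ∃ u v, u.length = n ∧ w = prepend u v := by
  induction n generalizing w with
  | zero => exact ⟨[], w, rfl, rfl⟩
  | succ n ih =>
    obtain ⟨u, v, rfl, hw⟩ := ih fun n => w (n + 1)
    exact ⟨w 0 :: u, v, rfl, funext fun n => Nat.casesOn n rfl (congrFun hw)⟩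

theorem prepend_apply_of_lt {u : List α} {n : ℕ} (h : n < u.length) (w v : ℕ → α) :
    prepend u w n = prepend u v n := by
  induction u generalizing n with
  | nil => simp at h
  | cons a u ih =>
    cases n with
    | zero => rfl
    | succ n => exact ih (by simpa using h)

theorem prepend_apply_mem {u : List α} {n : ℕ} (h : n < u.length) (w : ℕ → α) :
    prepend u w n ∈ u := by
  induction u generalizing n with
  | nil => simp at h
  | cons a u ih =>
    cases n with
    | zero => exact List.mem_cons_self
    | succ n => exact List.mem_cons_of_mem a (ih (by simpa using h))

theorem prepend_apply_add (u : List α) (w : ℕ → α) (n : ℕ) : prepend u w (n + u.length) = w n := by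
  induction u with
  | nil => rfl
  | cons _ _ ih => exact ih

theorem exists_prepend_cons_of_ne {w z : ℕ → α} (h : w ≠ z) :
    ∃ u a b w' z', a ≠ b ∧ w = prepend u (prepend [a] w') ∧ z = prepend u (prepend [b] z') := by
  have hdecomp (y : ℕ → α) : y = prepend [y 0] fun n => y (n + 1) :=
    funext fun n => Nat.casesOn n rfl fun _ => rfl
  obtain ⟨n, hn⟩ := Function.ne_iff.mp h
  clear h
  induction n generalizing w z with
  | zero => exact ⟨[], _, _, _, _, hn, hdecomp w, hdecomp z⟩
  | succ n ih =>
    rcases ne_or_eq (w 0) (z 0) with h0 | h0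
    · exact ⟨[], _, _, _, _, h0, hdecomp w, hdecomp z⟩
    · obtain ⟨u, a, b, w', z', hab, hw, hz⟩ :=
        ih (w := fun n => w (n + 1)) (z := fun n => z (n + 1)) hn
      refine ⟨w 0 :: u, a, b, w', z', hab, (hdecomp w).trans ?_, (hdecomp z).trans ?_⟩
      · rw [hw]
        exact (prepend_append [w 0] u _).symm
      · rw [hz, h0]
        exact (prepend_append [z 0] u _).symm

theorem exists_append_of_prepend_eq_prepend {u v : List α} {w z : ℕ → α}
    (h : prepend u w = prepend v z) :
    (∃ t, v = u ++ t ∧ w = prepend t z) ∨ ∃ t, u = v ++ t ∧ z = prepend t w := by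
  induction u generalizing v with
  | nil => exact .inl ⟨v, rfl, h⟩
  | cons a u ih =>
    cases v with
    | nil => exact .inr ⟨a :: u, rfl, h.symm⟩
    | cons b v =>
      obtain ⟨rfl, hwz⟩ := prepend_cons_eq_prepend_cons.mp h
      simpa only [List.cons_append, List.cons.injEq, true_and] using ih hwz

theorem eq_of_prepend_eq_self {u : List α} (hu : u ≠ []) {w z : ℕ → α} (hw : prepend u w = w)
    (hz : prepend u z = z) : w = z := by
  have hpos := List.length_pos_of_ne_nil hu
  funext n
  induction n using Nat.strong_induction_on with
  | _ n ih =>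
    rw [← hw, ← hz]
    rcases lt_or_ge n u.length with h | h
    · exact prepend_apply_of_lt h _ _
    · obtain ⟨m, rfl⟩ := Nat.exists_eq_add_of_le' h
      rw [prepend_apply_add, prepend_apply_add]
      exact ih m (by omega)

theorem subsingleton_prepend_eq_prepend {u v : List α} (huv : u ≠ v) :
    {w : ℕ → α | prepend u w = prepend v w}.Subsingleton := by
  intro w hw z hz
  rw [mem_ofPred_eq] at hw hz
  rcases exists_append_of_prepend_eq_prepend hw with ⟨t, rfl, ht⟩ | ⟨t, rfl, ht⟩
  · rw [prepend_append] at hz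
    exact eq_of_prepend_eq_self (by simpa using huv) ht.symm (prepend_injective u hz).symm
  · rw [prepend_append] at hz
    exact eq_of_prepend_eq_self (by simpa using huv.symm) ht.symm (prepend_injective v hz)

variable [TopologicalSpace α]

theorem continuous_prepend (u : List α) : Continuous (prepend u) := by
  induction u with
  | nil => exact continuous_id
  | cons a u ih =>
    refine continuous_pi fun n => ?_
    cases n with
    | zero => exact continuous_const
    | succ n => exact (continuous_apply n).comp ih

variable [DiscreteTopology α]

theorem exists_range_prepend_subset {w : ℕ → α} {s : Set (ℕ → α)} (hs : s ∈ 𝓝 w) (N : ℕ) :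
    ∃ u v, N ≤ u.length ∧ w = prepend u v ∧ range (prepend u) ⊆ s := by
  obtain ⟨_, ⟨x, n, rfl⟩, hw, hxs⟩ :=
    (PiNat.isTopologicalBasis_cylinders fun _ : ℕ => α).mem_nhds_iff.mp hs
  obtain ⟨u, v, hu, rfl⟩ := exists_eq_prepend (max n N) w
  refine ⟨u, v, hu ▸ le_max_right n N, rfl, ?_⟩
  rintro _ ⟨z, rfl⟩
  exact hxs fun i hi => (prepend_apply_of_lt (hu ▸ lt_max_of_lt_left hi) z v).trans (hw i hi)

theorem isOpen_range_prepend (u : List α) : IsOpen (range (prepend u)) := by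
  refine isOpen_iff_mem_nhds.mpr ?_
  rintro _ ⟨w, rfl⟩
  filter_upwards [(PiNat.isOpen_cylinder _ (prepend u w) u.length).mem_nhds
    (PiNat.self_mem_cylinder _ _)] with y hy
  refine ⟨fun n => y (n + u.length), funext fun n => ?_⟩
  rcases lt_or_ge n u.length with h | h
  · exact (prepend_apply_of_lt h _ w).trans (hy n h).symm
  · obtain ⟨m, rfl⟩ := Nat.exists_eq_add_of_le' h
    exact prepend_apply_add u _ m

theorem isOpenEmbedding_prepend (u : List α) : IsOpenEmbedding (prepend u) where
  toIsEmbedding := Function.LeftInverse.isEmbedding (f := fun w n => w (n + u.length))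
    (fun w => funext (prepend_apply_add u w)) (by fun_prop) (continuous_prepend u)
  isOpen_range := isOpen_range_prepend u

end Words

instance perfectSpace_pi {ι X : Type*} [Infinite ι] [TopologicalSpace X] [Nontrivial X] :
    PerfectSpace (ι → X) := by
  classical
  refine perfectSpace_iff_forall_not_isolated.mpr fun x => ?_
  choose y hy using fun i => exists_ne (x i)
  have hlim : Filter.Tendsto (fun i => Function.update x i (y i)) Filter.cofinite (𝓝[≠] x) := by
    refine tendsto_nhdsWithin_iff.mpr ⟨tendsto_pi_nhds.mpr fun j => ?_, .of_forall fun i => ?_⟩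
    · refine tendsto_nhds_of_eventually_eq ?_
      filter_upwards [Filter.eventually_cofinite_ne j] with i hi
      exact Function.update_of_ne hi.symm _ _
    · exact fun h => hy i (by simpa using congrFun h i)
  exact hlim.neBot

/-! ### Prefix replacement -/

section CarriesPrefix

variable {G α : Type*} [Group G] [MulAction G (ℕ → α)] {f g : G} {u v t : List α}

/-- On the words that start with `u`, the element `f` replaces the prefix `u` by `v`. -/
def CarriesPrefix (f : G) (u v : List α) : Prop := ∀ w, f • prepend u w = prepend v w

theorem CarriesPrefix.append (h : CarriesPrefix f u v) (t : List α) :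
    CarriesPrefix f (u ++ t) (v ++ t) := fun w => by
  rw [prepend_append, prepend_append, h]

theorem CarriesPrefix.mul (hg : CarriesPrefix g v t) (hf : CarriesPrefix f u v) :
    CarriesPrefix (g * f) u t := fun w => by
  rw [mul_smul, hf, hg]

theorem CarriesPrefix.inv (h : CarriesPrefix f u v) : CarriesPrefix f⁻¹ v u := fun w => by
  rw [inv_smul_eq_iff, h]

theorem CarriesPrefix.one (u : List α) : CarriesPrefix (1 : G) u u := fun _ => one_smul G _

variable [TopologicalSpace α] [DiscreteTopology α]

theorem CarriesPrefix.continuousAt (h : CarriesPrefix f u v) (w : ℕ → α) :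
    ContinuousAt (f • ·) (prepend u w) := by
  rw [← (isOpenEmbedding_prepend u).continuousAt_iff]
  exact ((continuous_prepend v).congr fun w => (h w).symm).continuousAt

theorem CarriesPrefix.eventually_smul_eq_or_ne (h : CarriesPrefix f u v) (w : ℕ → α) :
    (∀ᶠ z in 𝓝 (prepend u w), f • z = z) ∨ ∀ᶠ z in 𝓝[≠] prepend u w, f • z ≠ z := by
  have hcyl : ∀ᶠ z in 𝓝 (prepend u w), z ∈ range (prepend u) :=
    (isOpen_range_prepend u).mem_nhds ⟨w, rfl⟩
  rcases eq_or_ne v u with rfl | hvu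
  · left
    filter_upwards [hcyl]
    rintro _ ⟨z, rfl⟩
    exact h z
  · right
    have hfin := ((subsingleton_prepend_eq_prepend hvu).finite.image (prepend u))
    filter_upwards [nhdsWithin_le_nhds hcyl,
      nhdsNE_le_cofinite (prepend u w) hfin.compl_mem_cofinite]
    rintro _ ⟨z, rfl⟩ hz hfix
    exact hz ⟨z, (h z).symm.trans hfix, rfl⟩

end CarriesPrefix

/-! ### Dyadic intervals -/

theorem prepend_cons_eq_consWord (a : Fin 2) (u : List (Fin 2)) (w : BinSeq) :
    prepend (a :: u) w = consWord a (prepend u w) :=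
  funext fun n => Nat.casesOn n rfl fun _ => rfl

theorem endsInZeros_prepend_iff (u : List (Fin 2)) (w : BinSeq) :
    EndsInZeros (prepend u w) ↔ EndsInZeros w := by
  rw [← endsInZeros_shift_iff _ u.length]
  simp only [prepend_apply_add]

theorem coe_binVal_prepend_cons (a : Fin 2) (u : List (Fin 2)) (w : BinSeq) :
    (binVal (prepend (a :: u) w) : ℝ) = (a + binVal (prepend u w)) / 2 := by
  rw [prepend_cons_eq_consWord, coe_binVal_consWord, add_div]

theorem exists_coe_binVal_prepend (u : List (Fin 2)) :
    ∃ p : ℕ, ∀ w, (binVal (prepend u w) : ℝ) = (p + binVal w) / 2 ^ u.length := by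
  induction u with
  | nil => exact ⟨0, by simp⟩
  | cons a u ih =>
    obtain ⟨p, hp⟩ := ih
    refine ⟨a * 2 ^ u.length + p, fun w => ?_⟩
    rw [coe_binVal_prepend_cons, hp, List.length_cons]
    push_cast
    field_simp
    ring

theorem exists_word_of_lt_two_pow {q p : ℕ} (h : p < 2 ^ q) :
    ∃ u : List (Fin 2), ∀ w, (binVal (prepend u w) : ℝ) = (p + binVal w) / 2 ^ q := by
  induction q generalizing p with
  | zero =>
    obtain rfl : p = 0 := by simpa using h
    exact ⟨[], by simp⟩
  | succ q ih =>
    obtain ⟨a, r, rfl, hr⟩ : ∃ (a : Fin 2) (r : ℕ), p = a * 2 ^ q + r ∧ r < 2 ^ q :=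
      ⟨⟨p / 2 ^ q, Nat.div_lt_of_lt_mul (by rwa [← pow_succ])⟩, p % 2 ^ q,
        (Nat.div_add_mod' p _).symm, Nat.mod_lt p (by positivity)⟩
    obtain ⟨u, hu⟩ := ih hr
    refine ⟨a :: u, fun w => ?_⟩
    rw [coe_binVal_prepend_cons, hu]
    push_cast
    field_simp
    ring

theorem coe_binVal_zeros : (binVal fun _ => 0 : ℝ) = 0 := by
  simp [binVal, Real.ofDigits, Real.ofDigitsTerm]

theorem coe_binVal_ones : (binVal fun _ => 1 : ℝ) = 1 := Real.ofDigits_const_last_eq_one 1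

theorem surjective_binVal : Function.Surjective binVal := fun t => by
  obtain ⟨w, -, hw⟩ := Real.ofDigits_SurjOn (b := 2) (by norm_num) t.2
  exact ⟨w, Subtype.ext hw⟩

/-- The left end point of the dyadic interval formed by the points whose binary expansions start
with `u`. -/
noncomputable def leftEnd (u : List (Fin 2)) : I := binVal (prepend u fun _ => 0)

/-- The right end point of the dyadic interval formed by the points whose binary expansions start
with `u`. -/
noncomputable def rightEnd (u : List (Fin 2)) : I := binVal (prepend u fun _ => 1)

theorem coe_leftEnd_cons (a : Fin 2) (u : List (Fin 2)) :
    (leftEnd (a :: u) : ℝ) = (a + leftEnd u) / 2 :=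
  coe_binVal_prepend_cons a u _

theorem coe_rightEnd_cons (a : Fin 2) (u : List (Fin 2)) :
    (rightEnd (a :: u) : ℝ) = (a + rightEnd u) / 2 :=
  coe_binVal_prepend_cons a u _

theorem leftEnd_lt_rightEnd (u : List (Fin 2)) : leftEnd u < rightEnd u := by
  obtain ⟨p, hp⟩ := exists_coe_binVal_prepend u
  rw [← Subtype.coe_lt_coe, leftEnd, rightEnd, hp, hp, coe_binVal_zeros, coe_binVal_ones]
  gcongr
  exact zero_lt_one

theorem binVal_image_range_prepend (u : List (Fin 2)) :
    binVal '' range (prepend u) = Icc (leftEnd u) (rightEnd u) := by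
  obtain ⟨p, hp⟩ := exists_coe_binVal_prepend u
  have hpos : (0 : ℝ) < 2 ^ u.length := by positivity
  ext y
  rw [mem_Icc, ← Subtype.coe_le_coe, ← Subtype.coe_le_coe, leftEnd, rightEnd, hp, hp,
    coe_binVal_zeros, coe_binVal_ones, div_le_iff₀ hpos, le_div_iff₀ hpos]
  constructor
  · rintro ⟨_, ⟨w, rfl⟩, rfl⟩
    rw [hp, div_mul_cancel₀ _ hpos.ne']
    exact ⟨by linarith [(binVal w).2.1], by linarith [(binVal w).2.2]⟩
  · rintro ⟨h0, h1⟩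
    obtain ⟨w, hw⟩ := surjective_binVal ⟨y * 2 ^ u.length - p, by linarith, by linarith⟩
    refine ⟨_, ⟨w, rfl⟩, Subtype.ext ?_⟩
    rw [hp, hw, add_sub_cancel, mul_div_cancel_right₀ _ hpos.ne']

/-! ### Elements of `F` as prefix replacements -/

theorem ThompsonF.smul_zero (f : ThompsonF) : f • (0 : I) = 0 :=
  strictMono_homeomorph_zero f.1 f.2.1

theorem cantor_smul_eq_self_iff {f : ThompsonF} {w : BinSeq} :
    f • w = w ↔ f • binVal w = binVal w :=
  ⟨fun h => by rw [← (cantor_smul_spec f w).1, h], fun h => cantor_smul_eq_of h.symm Iff.rfl⟩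

/-- The element `f` of `F` replaces the prefix `u` of infinite words by another prefix. -/
def ReplacesPrefix (f : ThompsonF) (u : List (Fin 2)) : Prop := ∃ v, CarriesPrefix f u v

theorem replacesPrefix_of_coe_smul_binVal_eq {f : ThompsonF} {u : List (Fin 2)} {p : ℤ} {q : ℕ}
    (h : ∀ w, ((f • binVal (prepend u w) : I) : ℝ) = (p + binVal w) / 2 ^ q) :
    ReplacesPrefix f u := by
  have hpos : (0 : ℝ) < 2 ^ q := by positivity
  have hp0 : 0 ≤ p := by
    have hle := (f • binVal (prepend u fun _ => 0) : I).2.1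
    rw [h, coe_binVal_zeros, add_zero, le_div_iff₀ hpos, zero_mul] at hle
    exact_mod_cast hle
  have hp1 : p + 1 ≤ 2 ^ q := by
    have hle := (f • binVal (prepend u fun _ => 1) : I).2.2
    rw [h, coe_binVal_ones, div_le_iff₀ hpos, one_mul] at hle
    exact_mod_cast hle
  lift p to ℕ using hp0
  obtain ⟨v, hv⟩ := exists_word_of_lt_two_pow (q := q) (p := p) (by exact_mod_cast hp1)
  refine ⟨v, fun w => cantor_smul_eq_of (Subtype.ext ?_) ?_⟩
  · rw [hv, h, Int.cast_natCast]
  · rw [endsInZeros_prepend_iff, endsInZeros_prepend_iff]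

theorem replacesPrefix_of_affine {f : ThompsonF} {u : List (Fin 2)} {k l : ℤ} {m : ℕ}
    (hf : ∀ w, ((f • binVal (prepend u w) : I) : ℝ) = 2 ^ k * binVal (prepend u w) + l / 2 ^ m)
    (hu : m + k ≤ u.length) : ReplacesPrefix f u := by
  obtain ⟨p, hp⟩ := exists_coe_binVal_prepend u
  obtain ⟨r, hr⟩ := Int.eq_ofNat_of_zero_le (sub_nonneg.mpr hu)
  have hk : (2 : ℝ) ^ k = 2 ^ u.length / 2 ^ (m + r) := by
    rw [← zpow_natCast, ← zpow_natCast, ← zpow_sub₀ two_ne_zero]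
    congr 1
    push_cast
    omega
  refine replacesPrefix_of_coe_smul_binVal_eq (p := p + l * 2 ^ r) (q := m + r) fun w => ?_
  rw [hf, hp, hk, pow_add]
  push_cast
  field_simp
  ring

theorem IsDyadic.eventually_not_between {r : ℝ} (hr : IsDyadic r) :
    ∀ᶠ N : ℕ in Filter.atTop, ∀ p : ℕ, ¬ ((p : ℝ) / 2 ^ N < r ∧ r < (p + 1) / 2 ^ N) := by
  obtain ⟨k, m, rfl⟩ := hr
  filter_upwards [Filter.eventually_ge_atTop m] with N hN p
  obtain ⟨n, rfl⟩ := Nat.exists_eq_add_of_le hN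
  have hpos : (0 : ℝ) < 2 ^ (m + n) := by positivity
  rw [← mul_div_mul_right (k : ℝ) _ (pow_ne_zero n two_ne_zero), ← pow_add,
    div_lt_div_iff_of_pos_right hpos, div_lt_div_iff_of_pos_right hpos]
  rintro ⟨h1, h2⟩
  have h1' : (p : ℤ) < k * 2 ^ n := by exact_mod_cast h1
  have h2' : k * 2 ^ n < (p : ℤ) + 1 := by exact_mod_cast h2
  omega

theorem exists_forall_affine (f : ThompsonF) :
    ∃ N : ℕ, ∀ u : List (Fin 2), u.length = N → ∃ (k l : ℤ) (m : ℕ), ∀ w,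
      ((f • binVal (prepend u w) : I) : ℝ) = 2 ^ k * binVal (prepend u w) + l / 2 ^ m := by
  obtain ⟨B, hB, hlin⟩ := f.2.2
  obtain ⟨N, hN⟩ :=
    ((Filter.eventually_all_finset B).mpr fun b hb => (hB b hb).eventually_not_between).exists
  refine ⟨N, fun u hu => ?_⟩
  obtain ⟨k, c, hc⟩ := hlin _ _ (leftEnd_lt_rightEnd u) fun b hb hbt => by
    obtain ⟨p, hp⟩ := exists_coe_binVal_prepend u
    refine hN b hb p ?_
    rwa [← Subtype.coe_lt_coe, ← Subtype.coe_lt_coe, leftEnd, rightEnd, hp, hp,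
      coe_binVal_zeros, coe_binVal_ones, add_zero, hu] at hbt
  have haff : ∀ w, ((f • binVal (prepend u w) : I) : ℝ) = 2 ^ k * binVal (prepend u w) + c :=
    fun w => hc _ (binVal_image_range_prepend u ▸ mem_image_of_mem _ ⟨w, rfl⟩)
  obtain ⟨l, m, rfl⟩ : IsDyadic c := by
    have hleft : IsDyadic (leftEnd u) :=
      ((endsInZeros_prepend_iff u fun _ => 0).mpr ⟨0, fun _ _ => rfl⟩).isDyadic
    rw [← sub_eq_of_eq_add' (haff fun _ => 0), sub_eq_add_neg]
    exact (f.2.2.isDyadic_apply (ThompsonF.smul_zero f) hleft).add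
      ((IsDyadic.two_zpow k).mul hleft).neg
  exact ⟨k, l, m, haff⟩

theorem exists_forall_replacesPrefix (f : ThompsonF) :
    ∃ N : ℕ, ∀ u : List (Fin 2), u.length = N → ReplacesPrefix f u := by
  obtain ⟨N, hN⟩ := exists_forall_affine f
  choose! k l m hklm using hN
  obtain ⟨n, hn⟩ := ((Filter.eventually_all_finite (List.finite_length_eq (Fin 2) N)).mpr
    fun u _ => Filter.eventually_ge_atTop (m u + (k u).natAbs)).exists
  refine ⟨N + n, fun u hu => ?_⟩
  have htake : (u.take N).length = N := by simp [hu]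
  have hle := hn _ htake
  refine replacesPrefix_of_affine (k := k (u.take N)) (l := l (u.take N)) (m := m (u.take N))
    (fun w => ?_) (by omega)
  rw [← List.take_append_drop N u, prepend_append, List.take_left']
  · exact hklm _ htake _
  · exact htake

theorem exists_replacesPrefix (f : ThompsonF) (w : BinSeq) :
    ∃ u z, w = prepend u z ∧ ReplacesPrefix f u := by
  obtain ⟨N, hN⟩ := exists_forall_replacesPrefix f
  obtain ⟨u, z, hu, hw⟩ := exists_eq_prepend N w
  exact ⟨u, z, hw, hN u hu⟩

instance : ContinuousConstSMul ThompsonF BinSeq where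
  continuous_const_smul f := continuous_iff_continuousAt.mpr fun w => by
    obtain ⟨u, z, rfl, v, hv⟩ := exists_replacesPrefix f w
    exact hv.continuousAt z

instance : IsolatesFixedPoints ThompsonF BinSeq where
  eventually_smul_eq_or_ne f w := by
    obtain ⟨u, z, rfl, v, hv⟩ := exists_replacesPrefix f w
    exact hv.eventually_smul_eq_or_ne z

/-! ### Generation of `F` by `x₀` and `x₁` -/

theorem ThompsonF.smul_one (f : ThompsonF) : f • (1 : I) = 1 := by
  refine le_antisymm le_top ?_
  have hle : f • (f⁻¹ • (1 : I)) ≤ f • (1 : I) := f.2.1.monotone le_top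
  rwa [smul_inv_smul] at hle

theorem CarriesPrefix.smul_leftEnd {f : ThompsonF} {u v : List (Fin 2)}
    (h : CarriesPrefix f u v) : f • leftEnd u = leftEnd v := by
  rw [leftEnd, ← (cantor_smul_spec f _).1, h, leftEnd]

theorem CarriesPrefix.smul_rightEnd {f : ThompsonF} {u v : List (Fin 2)}
    (h : CarriesPrefix f u v) : f • rightEnd u = rightEnd v := by
  rw [rightEnd, ← (cantor_smul_spec f _).1, h, rightEnd]

theorem CarriesPrefix.smul_eq_smul {f g : ThompsonF} {u v : List (Fin 2)}
    (hf : CarriesPrefix f u v) (hg : CarriesPrefix g u v) {t : I}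
    (ht : t ∈ Icc (leftEnd u) (rightEnd u)) : f • t = g • t := by
  rw [← binVal_image_range_prepend] at ht
  obtain ⟨_, ⟨w, rfl⟩, rfl⟩ := ht
  rw [← (cantor_smul_spec f _).1, ← (cantor_smul_spec g _).1, hf, hg]

/-- The dyadic intervals of the words in the list, in this order, tile the interval from `s`
to `t`. -/
def Tiles : I → I → List (List (Fin 2)) → Prop
  | s, t, [] => s = t
  | s, t, u :: L => leftEnd u = s ∧ Tiles (rightEnd u) t L

theorem Tiles.append {r s t : I} {L M : List (List (Fin 2))} (hL : Tiles r s L)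
    (hM : Tiles s t M) : Tiles r t (L ++ M) := by
  induction L generalizing r with
  | nil => exact (hL : r = s) ▸ hM
  | cons u L ih => exact ⟨hL.1, ih hL.2⟩

theorem Tiles.smul {f : ThompsonF} {s t : I} {L M : List (List (Fin 2))} (hL : Tiles s t L)
    (hf : List.Forall₂ (CarriesPrefix f) L M) : Tiles (f • s) (f • t) M := by
  induction hf generalizing s with
  | nil => exact congrArg (f • ·) hL
  | cons hu _ ih => exact ⟨hu.smul_leftEnd.symm.trans (congrArg (f • ·) hL.1),
      hu.smul_rightEnd ▸ ih hL.2⟩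

theorem Tiles.le_leftEnd {s t : I} {L : List (List (Fin 2))} (hL : Tiles s t L)
    {u : List (Fin 2)} (hu : u ∈ L) : s ≤ leftEnd u := by
  induction L generalizing s with
  | nil => simp at hu
  | cons v L ih =>
    rcases List.mem_cons.mp hu with rfl | hu
    · exact hL.1.ge
    · exact hL.1.symm.trans_le ((leftEnd_lt_rightEnd v).le.trans (ih hL.2 hu))

theorem Tiles.smul_eq_smul {f g : ThompsonF} {s t y : I} {L M : List (List (Fin 2))}
    (hL : Tiles s t L) (hf : List.Forall₂ (CarriesPrefix f) L M)
    (hg : List.Forall₂ (CarriesPrefix g) L M) (hy : y ∈ Ioc s t) : f • y = g • y := by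
  induction hf generalizing s with
  | nil => exact absurd (hy.1.trans_le hy.2) (hL : s = t).not_lt
  | @cons u v L M hfu _ ih =>
    rcases le_or_gt y (rightEnd u) with h | h
    · exact hfu.smul_eq_smul (List.forall₂_cons.mp hg).1 ⟨hL.1.trans_le hy.1.le, h⟩
    · exact ih hL.2 (List.forall₂_cons.mp hg).2 ⟨h, hy.2⟩

theorem Tiles.eq_of_carriesPrefix {f g : ThompsonF} {L M : List (List (Fin 2))}
    (hL : Tiles 0 1 L) (hf : List.Forall₂ (CarriesPrefix f) L M)
    (hg : List.Forall₂ (CarriesPrefix g) L M) : f = g := by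
  refine Subtype.ext (Homeomorph.ext fun t => ?_)
  change f • t = g • t
  rcases eq_or_ne t 0 with rfl | ht
  · rw [ThompsonF.smul_zero, ThompsonF.smul_zero]
  · exact hL.smul_eq_smul hf hg ⟨bot_lt_iff_ne_bot.mpr ht, le_top⟩

theorem tiles_map_cons_iff {a : Fin 2} {s t s' t' : I} {L : List (List (Fin 2))}
    (hs : (s' : ℝ) = (a + s) / 2) (ht : (t' : ℝ) = (a + t) / 2) :
    Tiles s' t' (L.map (a :: ·)) ↔ Tiles s t L := by
  have key : ∀ {p q p' q' : I}, (p' : ℝ) = (a + p) / 2 → (q' : ℝ) = (a + q) / 2 →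
      (p' = q' ↔ p = q) := fun hp hq => by
    rw [← Subtype.coe_inj, ← Subtype.coe_inj, hp, hq, div_left_inj' two_ne_zero, add_right_inj]
  induction L generalizing s s' with
  | nil => exact key hs ht
  | cons u L ih => exact and_congr (key (coe_leftEnd_cons a u) hs) (ih (coe_rightEnd_cons a u))

theorem leftEnd_nil : leftEnd [] = 0 := Subtype.ext coe_binVal_zeros

theorem rightEnd_nil : rightEnd [] = 1 := Subtype.ext coe_binVal_ones

theorem exists_tiles_length_eq (n : ℕ) : ∃ L, Tiles 0 1 L ∧ ∀ u ∈ L, u.length = n := by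
  induction n with
  | zero => exact ⟨[[]], ⟨leftEnd_nil, rightEnd_nil⟩, by simp⟩
  | succ n ih =>
    obtain ⟨L, hL, hlen⟩ := ih
    let half : I := ⟨1 / 2, by norm_num, by norm_num⟩
    have h0 : Tiles 0 half (L.map (0 :: ·)) :=
      (tiles_map_cons_iff (by simp) (by simp [half])).mpr hL
    have h1 : Tiles half 1 (L.map (1 :: ·)) :=
      (tiles_map_cons_iff (by simp [half]) (by norm_num)).mpr hL
    refine ⟨_, h0.append h1, fun u hu => ?_⟩
    rcases List.mem_append.mp hu with hu | hu <;>
    · obtain ⟨v, hv, rfl⟩ := List.mem_map.mp hu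
      rw [List.length_cons, hlen v hv]

theorem exists_forall₂_carriesPrefix {f : ThompsonF} {L : List (List (Fin 2))}
    (h : ∀ u ∈ L, ReplacesPrefix f u) : ∃ M, List.Forall₂ (CarriesPrefix f) L M := by
  choose! v hv using h
  exact ⟨L.map v, List.forall₂_map_right_iff.mpr (List.forall₂_same.mpr hv)⟩

theorem Tiles.smul_zero_one {f : ThompsonF} {L M : List (List (Fin 2))} (hL : Tiles 0 1 L)
    (hf : List.Forall₂ (CarriesPrefix f) L M) : Tiles 0 1 M := by
  simpa only [ThompsonF.smul_zero, ThompsonF.smul_one] using hL.smul hf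

theorem exists_tiles_carriesPrefix (f : ThompsonF) :
    ∃ L M, Tiles 0 1 L ∧ Tiles 0 1 M ∧ List.Forall₂ (CarriesPrefix f) L M := by
  obtain ⟨N, hN⟩ := exists_forall_replacesPrefix f
  obtain ⟨L, hL, hlen⟩ := exists_tiles_length_eq N
  obtain ⟨M, hfM⟩ := exists_forall₂_carriesPrefix fun u hu => hN u (hlen u hu)
  exact ⟨L, M, hL, hL.smul_zero_one hfM, hfM⟩

theorem forall₂_carriesPrefix_mul {f g : ThompsonF} {L M N : List (List (Fin 2))}
    (hg : List.Forall₂ (CarriesPrefix g) M N) (hf : List.Forall₂ (CarriesPrefix f) L M) :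
    List.Forall₂ (CarriesPrefix (g * f)) L N := by
  induction hf generalizing N with
  | nil =>
    rw [List.forall₂_nil_left_iff.mp hg]
    exact .nil
  | cons hfu _ ih =>
    obtain ⟨_, N, hgu, hgM, rfl⟩ := List.forall₂_cons_left_iff.mp hg
    exact .cons (hgu.mul hfu) (ih hgM)

theorem forall₂_carriesPrefix_inv {f : ThompsonF} {L M : List (List (Fin 2))}
    (hf : List.Forall₂ (CarriesPrefix f) L M) : List.Forall₂ (CarriesPrefix f⁻¹) M L :=
  (hf.imp fun _ _ => CarriesPrefix.inv).flip

theorem carriesPrefix_x₀_zero : CarriesPrefix x₀ ([0] : List (Fin 2)) [0, 0] := fun w => by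
  simpa only [prepend_cons_eq_consWord, prepend_nil] using (x₀_smul_word w).1

theorem carriesPrefix_x₀_one_zero : CarriesPrefix x₀ ([1, 0] : List (Fin 2)) [0, 1] := fun w => by
  simpa only [prepend_cons_eq_consWord, prepend_nil] using (x₀_smul_word w).2.1

theorem carriesPrefix_x₀_one_one : CarriesPrefix x₀ ([1, 1] : List (Fin 2)) [1] := fun w => by
  simpa only [prepend_cons_eq_consWord, prepend_nil] using (x₀_smul_word w).2.2

theorem carriesPrefix_x₁_zero : CarriesPrefix x₁ ([0] : List (Fin 2)) [0] := fun w => by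
  simpa only [prepend_cons_eq_consWord, prepend_nil] using (x₁_smul_word w).1

theorem exists_eq_prepend_singleton (w : BinSeq) :
    (∃ z, w = prepend [0] z) ∨ ∃ z, w = prepend [1] z := by
  obtain ⟨u, z, hu, rfl⟩ := exists_eq_prepend 1 w
  obtain ⟨a, rfl⟩ := List.length_eq_one_iff.mp hu
  fin_cases a
  exacts [.inl ⟨z, rfl⟩, .inr ⟨z, rfl⟩]

theorem x₁_smul_prepend_one (w : BinSeq) : x₁ • prepend [1] w = prepend [1] (x₀ • w) := by
  rcases exists_eq_prepend_singleton w with ⟨w, rfl⟩ | ⟨w, rfl⟩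
  · rw [carriesPrefix_x₀_zero]
    simpa only [prepend_cons_eq_consWord, prepend_nil] using (x₁_smul_word w).2.1
  rcases exists_eq_prepend_singleton w with ⟨w, rfl⟩ | ⟨w, rfl⟩
  · rw [← prepend_append [1] [0] w, List.singleton_append, carriesPrefix_x₀_one_zero]
    simpa only [prepend_cons_eq_consWord, prepend_nil] using (x₁_smul_word w).2.2.1
  · rw [← prepend_append [1] [1] w, List.singleton_append, carriesPrefix_x₀_one_one]
    simpa only [prepend_cons_eq_consWord, prepend_nil] using (x₁_smul_word w).2.2.2

theorem conj_x₁_smul_prepend_one (w : BinSeq) :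
    x₀⁻¹ • x₁ • x₀ • prepend [1] w = prepend [1] (x₁ • w) := by
  rcases exists_eq_prepend_singleton w with ⟨w, rfl⟩ | ⟨w, rfl⟩
  · rw [carriesPrefix_x₁_zero, ← prepend_append, List.singleton_append, inv_smul_eq_iff,
      carriesPrefix_x₀_one_zero]
    exact carriesPrefix_x₁_zero.append [1] w
  · rw [x₁_smul_prepend_one, ← prepend_append, ← prepend_append, List.singleton_append,
      inv_smul_eq_iff, carriesPrefix_x₀_one_one, carriesPrefix_x₀_one_one, x₁_smul_prepend_one]

theorem exists_smul_prepend_one {f : ThompsonF} (hf : f ∈ Subgroup.closure {x₀, x₁}) :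
    ∃ g ∈ Subgroup.closure {x₀, x₁}, CarriesPrefix g ([0] : List (Fin 2)) [0] ∧
      ∀ w : BinSeq, g • prepend [1] w = prepend [1] (f • w) := by
  have hx₀ : x₀ ∈ Subgroup.closure {x₀, x₁} := Subgroup.subset_closure (.inl rfl)
  have hx₁ : x₁ ∈ Subgroup.closure {x₀, x₁} := Subgroup.subset_closure (.inr rfl)
  induction hf using Subgroup.closure_induction with
  | mem f hf =>
    rcases hf with rfl | rfl
    · exact ⟨x₁, hx₁, carriesPrefix_x₁_zero, x₁_smul_prepend_one⟩
    · exact ⟨x₀⁻¹ * (x₁ * x₀), mul_mem (inv_mem hx₀) (mul_mem hx₁ hx₀),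
        carriesPrefix_x₀_zero.inv.mul ((carriesPrefix_x₁_zero.append [0]).mul
          carriesPrefix_x₀_zero), fun w => by
            rw [mul_smul, mul_smul, conj_x₁_smul_prepend_one]⟩
  | one => exact ⟨1, one_mem _, .one _, fun w => by rw [one_smul, one_smul]⟩
  | mul f₁ f₂ _ _ ih₁ ih₂ =>
    obtain ⟨g₁, hg₁, h₁, h₁'⟩ := ih₁
    obtain ⟨g₂, hg₂, h₂, h₂'⟩ := ih₂
    exact ⟨g₁ * g₂, mul_mem hg₁ hg₂, h₁.mul h₂, fun w => by rw [mul_smul, h₂', h₁', mul_smul]⟩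
  | inv f _ ih =>
    obtain ⟨g, hg, h, h'⟩ := ih
    exact ⟨g⁻¹, inv_mem hg, h.inv, fun w => by rw [inv_smul_eq_iff, h', smul_inv_smul]⟩

theorem leftEnd_zero_cons_lt (u : List (Fin 2)) : (leftEnd (0 :: u) : ℝ) < 1 / 2 := by
  have hlt := (leftEnd_lt_rightEnd u).trans_le le_top
  rw [coe_leftEnd_cons, Fin.val_zero, Nat.cast_zero, zero_add]
  gcongr
  exact hlt

theorem rightEnd_zero_cons_le (u : List (Fin 2)) : (rightEnd (0 :: u) : ℝ) ≤ 1 / 2 := by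
  rw [coe_rightEnd_cons, Fin.val_zero, Nat.cast_zero, zero_add]
  gcongr
  exact (rightEnd u).2.2

theorem half_le_leftEnd_one_cons (u : List (Fin 2)) : 1 / 2 ≤ (leftEnd (1 :: u) : ℝ) := by
  rw [coe_leftEnd_cons, Fin.val_one, Nat.cast_one]
  linarith [(leftEnd u).2.1]

theorem leftEnd_one_cons_ne_zero (u : List (Fin 2)) : leftEnd (1 :: u) ≠ 0 := fun h => by
  have := half_le_leftEnd_one_cons u
  norm_num [h] at this

theorem leftEnd_zero_cons_eq_zero_iff {u : List (Fin 2)} :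
    leftEnd (0 :: u) = 0 ↔ leftEnd u = 0 := by
  rw [← Subtype.coe_inj, ← Subtype.coe_inj, coe_leftEnd_cons]
  simp

theorem eq_nil_of_leftEnd_of_rightEnd {u : List (Fin 2)} (h0 : leftEnd u = 0)
    (h1 : rightEnd u = 1) : u = [] := by
  match u with
  | [] => rfl
  | 0 :: u =>
    have := rightEnd_zero_cons_le u
    norm_num [h1] at this
  | 1 :: u => exact absurd h0 (leftEnd_one_cons_ne_zero u)

theorem exists_eq_map_one_cons_of_half_le {L : List (List (Fin 2))}
    (h : ∀ u ∈ L, 1 / 2 ≤ (leftEnd u : ℝ)) : ∃ M : List (List (Fin 2)), L = M.map (1 :: ·) := by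
  suffices L ∈ range (List.map (1 :: ·)) from this.imp fun _ => Eq.symm
  rw [range_list_map]
  intro u hu
  match u with
  | [] => exact absurd (h [] hu) (by norm_num [leftEnd_nil])
  | 0 :: u => exact absurd (h _ hu) (leftEnd_zero_cons_lt u).not_ge
  | 1 :: u => exact ⟨u, rfl⟩

theorem replacesPrefix_x₀_inv {u : List (Fin 2)} (hu : leftEnd u ≠ 0) :
    ReplacesPrefix x₀⁻¹ u := by
  match u with
  | [] => exact absurd leftEnd_nil hu
  | [0] => exact absurd (leftEnd_zero_cons_eq_zero_iff.mpr leftEnd_nil) hu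
  | 0 :: 0 :: u => exact ⟨_, carriesPrefix_x₀_zero.inv.append u⟩
  | 0 :: 1 :: u => exact ⟨_, carriesPrefix_x₀_one_zero.inv.append u⟩
  | 1 :: u => exact ⟨_, carriesPrefix_x₀_one_one.inv.append u⟩

theorem Tiles.exists_carriesPrefix_zero {u : List (Fin 2)} {L : List (List (Fin 2))}
    (h : Tiles 0 1 ((0 :: u) :: L)) : ∃ f ∈ Subgroup.closure {x₀, x₁}, ∃ M,
      List.Forall₂ (CarriesPrefix f) ((0 :: u) :: L) ([0] :: M) := by
  induction u generalizing L with
  | nil => exact ⟨1, one_mem _, L, List.forall₂_same.mpr fun u _ => .one u⟩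
  | cons a u ih =>
    obtain rfl : a = 0 := by
      refine (Fin.exists_fin_two.mp (⟨a, rfl⟩ : ∃ b, a = b)).elim id ?_
      rintro rfl
      exact absurd (leftEnd_zero_cons_eq_zero_iff.mp h.1) (leftEnd_one_cons_ne_zero u)
    have hpos : ∀ v ∈ L, leftEnd v ≠ 0 := fun v hv =>
      (bot_lt_of_lt ((leftEnd_lt_rightEnd _).trans_le (h.2.le_leftEnd hv))).ne'
    obtain ⟨M, hM⟩ := exists_forall₂_carriesPrefix fun v hv => replacesPrefix_x₀_inv (hpos v hv)
    have hx₀ : List.Forall₂ (CarriesPrefix x₀⁻¹) ((0 :: 0 :: u) :: L) ((0 :: u) :: M) :=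
      .cons (carriesPrefix_x₀_zero.inv.append u) hM
    obtain ⟨f, hf, N, hN⟩ := ih (h.smul_zero_one hx₀)
    exact ⟨f * x₀⁻¹, mul_mem hf (inv_mem (Subgroup.subset_closure (.inl rfl))), N,
      forall₂_carriesPrefix_mul hN hx₀⟩

/-- The words `0`, `10`, …, `1ⁿ⁻¹0`, `1ⁿ`, whose dyadic intervals form the tiling that serves as a
normal form for the tilings by `n + 1` intervals. -/
def vine : ℕ → List (List (Fin 2))
  | 0 => [[]]
  | n + 1 => [0] :: (vine n).map (1 :: ·)

theorem Tiles.exists_eq_zero_cons {u v : List (Fin 2)} {L : List (List (Fin 2))}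
    (h : Tiles 0 1 (u :: v :: L)) : ∃ t, u = 0 :: t := by
  match u with
  | [] =>
    have hv := h.2.1.symm.trans_lt (leftEnd_lt_rightEnd v)
    rw [rightEnd_nil] at hv
    exact absurd hv not_top_lt
  | 0 :: u => exact ⟨u, rfl⟩
  | 1 :: u => exact absurd h.1 (leftEnd_one_cons_ne_zero u)

theorem Tiles.exists_eq_map_one_cons {M : List (List (Fin 2))} (h : Tiles 0 1 ([0] :: M)) :
    ∃ N : List (List (Fin 2)), M = N.map (1 :: ·) ∧ Tiles 0 1 N := by
  have hright : (rightEnd [0] : ℝ) = 1 / 2 := by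
    rw [coe_rightEnd_cons, rightEnd_nil]
    norm_num
  obtain ⟨N, rfl⟩ := exists_eq_map_one_cons_of_half_le fun u hu =>
    hright.symm.trans_le (h.2.le_leftEnd hu)
  exact ⟨N, rfl, (tiles_map_cons_iff (by simp [hright]) (by norm_num)).mp h.2⟩

theorem Tiles.exists_carriesPrefix_vine {n : ℕ} {L : List (List (Fin 2))} (h : Tiles 0 1 L)
    (hlen : L.length = n + 1) :
    ∃ f ∈ Subgroup.closure {x₀, x₁}, List.Forall₂ (CarriesPrefix f) L (vine n) := by
  induction n generalizing L with
  | zero =>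
    obtain ⟨u, rfl⟩ := List.length_eq_one_iff.mp hlen
    obtain rfl := eq_nil_of_leftEnd_of_rightEnd h.1 h.2
    exact ⟨1, one_mem _, .cons (.one _) .nil⟩
  | succ n ih =>
    obtain ⟨u, L, rfl⟩ := List.exists_cons_of_length_eq_add_one hlen
    obtain ⟨v, L, rfl⟩ := List.exists_cons_of_length_eq_add_one (Nat.succ.inj hlen)
    obtain ⟨u, rfl⟩ := h.exists_eq_zero_cons
    obtain ⟨f, hf, M, hfM⟩ := h.exists_carriesPrefix_zero
    obtain ⟨N, rfl, hN⟩ := (h.smul_zero_one hfM).exists_eq_map_one_cons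
    obtain ⟨g, hg, hgN⟩ := ih hN (by simpa [hlen] using hfM.length_eq.symm)
    obtain ⟨g', hg', hg0, hg1⟩ := exists_smul_prepend_one hg
    refine ⟨g' * f, mul_mem hg' hf, forall₂_carriesPrefix_mul (.cons hg0 ?_) hfM⟩
    refine List.forall₂_map_left_iff.mpr (List.forall₂_map_right_iff.mpr ?_)
    exact hgN.imp fun v t hvt w => by
      rw [← List.singleton_append, prepend_append, hg1, hvt, ← prepend_append,
        List.singleton_append]

theorem Tiles.length_pos {L : List (List (Fin 2))} (h : Tiles 0 1 L) : 0 < L.length :=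
  List.length_pos_of_ne_nil fun hL => zero_ne_one (hL ▸ h : Tiles 0 1 [])

theorem closure_x₀_x₁ : Subgroup.closure {x₀, x₁} = ⊤ := by
  refine (Subgroup.eq_top_iff' _).mpr fun f => ?_
  obtain ⟨L, M, hL, hM, hf⟩ := exists_tiles_carriesPrefix f
  obtain ⟨n, hn⟩ := Nat.exists_eq_add_one.mpr hL.length_pos
  obtain ⟨g, hg, hgL⟩ := hL.exists_carriesPrefix_vine hn
  obtain ⟨h, hh, hhM⟩ := hM.exists_carriesPrefix_vine (hf.length_eq ▸ hn)
  have hfgh : f = h⁻¹ * g :=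
    hL.eq_of_carriesPrefix hf (forall₂_carriesPrefix_mul (forall₂_carriesPrefix_inv hhM) hgL)
  exact hfgh ▸ mul_mem (inv_mem hh) hg

theorem surjective_lift_x₀_x₁ : Function.Surjective (FreeGroup.lift ![x₀, x₁]) := by
  rw [← MonoidHom.range_eq_top, FreeGroup.range_lift_eq_closure, ← closure_x₀_x₁,
    Matrix.range_cons, Matrix.range_cons, Matrix.range_empty, union_empty, singleton_union]

/-! ### Dynamics of `F` on infinite binary words -/

/-- Some element of `F` replaces the prefix `u` of infinite words by `v`. -/
def PrefixEquiv (u v : List (Fin 2)) : Prop := ∃ f : ThompsonF, CarriesPrefix f u v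

namespace PrefixEquiv

variable {u v t : List (Fin 2)}

theorem refl (u : List (Fin 2)) : PrefixEquiv u u := ⟨1, .one u⟩

theorem symm : PrefixEquiv u v → PrefixEquiv v u := fun ⟨f, hf⟩ => ⟨f⁻¹, hf.inv⟩

theorem trans : PrefixEquiv u v → PrefixEquiv v t → PrefixEquiv u t :=
  fun ⟨f, hf⟩ ⟨g, hg⟩ => ⟨g * f, hg.mul hf⟩

theorem append (h : PrefixEquiv u v) (t : List (Fin 2)) : PrefixEquiv (u ++ t) (v ++ t) :=
  h.imp fun _ hf => hf.append t

end PrefixEquiv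

theorem prefixEquiv_zero {u : List (Fin 2)} (hu : u ≠ []) (h1 : 1 ∉ u) : PrefixEquiv u [0] := by
  induction u using List.reverseRecOn with
  | nil => exact absurd rfl hu
  | append_singleton u a ih =>
    rw [List.mem_append, List.mem_singleton, not_or] at h1
    obtain rfl : a = 0 := by omega
    rcases eq_or_ne u [] with rfl | hu
    · exact .refl _
    · exact ((ih hu h1.1).append [0]).trans (PrefixEquiv.symm ⟨x₀, carriesPrefix_x₀_zero⟩)

theorem prefixEquiv_one {u : List (Fin 2)} (hu : u ≠ []) (h0 : 0 ∉ u) : PrefixEquiv u [1] := by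
  induction u using List.reverseRecOn with
  | nil => exact absurd rfl hu
  | append_singleton u a ih =>
    rw [List.mem_append, List.mem_singleton, not_or] at h0
    obtain rfl : a = 1 := by omega
    rcases eq_or_ne u [] with rfl | hu
    · exact .refl _
    · exact ((ih hu h0.1).append [1]).trans ⟨x₀, carriesPrefix_x₀_one_one⟩

theorem carriesPrefix_x₁_one_zero :
    CarriesPrefix x₁ ([1, 0] : List (Fin 2)) [1, 0, 0] := fun w => by
  simpa only [prepend_cons_eq_consWord, prepend_nil] using (x₁_smul_word w).2.1

theorem carriesPrefix_x₁_one_one_zero :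
    CarriesPrefix x₁ ([1, 1, 0] : List (Fin 2)) [1, 0, 1] := fun w => by
  simpa only [prepend_cons_eq_consWord, prepend_nil] using (x₁_smul_word w).2.2.1

theorem prefixEquiv_one_zero {u : List (Fin 2)} (h0 : 0 ∈ u) (h1 : 1 ∈ u) :
    PrefixEquiv u [1, 0] := by
  induction u using List.reverseRecOn with
  | nil => simp at h0
  | append_singleton u a ih =>
    rw [List.mem_append, List.mem_singleton] at h0 h1
    by_cases hu0 : 0 ∈ u
    · by_cases hu1 : 1 ∈ u
      · refine ((ih hu0 hu1).append [a]).trans (PrefixEquiv.symm ?_)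
        fin_cases a
        exacts [⟨x₁, carriesPrefix_x₁_one_zero⟩, PrefixEquiv.trans
          (PrefixEquiv.symm ⟨x₀, carriesPrefix_x₀_one_one.append [0]⟩)
          ⟨x₁, carriesPrefix_x₁_one_one_zero⟩]
      · obtain rfl := h1.resolve_left hu1
        exact ((prefixEquiv_zero (List.ne_nil_of_mem hu0) hu1).append [1]).trans
          (PrefixEquiv.symm ⟨x₀, carriesPrefix_x₀_one_zero⟩)
    · obtain rfl := h0.resolve_left hu0
      have hu1 := h1.resolve_right (by decide)
      exact (prefixEquiv_one (List.ne_nil_of_mem hu1) hu0).append [0]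

theorem exists_eq_zero_of_binVal_lt_one {w : BinSeq} (h : binVal w < 1) : ∃ n, w n = 0 := by
  by_contra! hw
  obtain rfl : w = fun _ => 1 := funext fun n => by have := hw n; omega
  exact h.ne (Subtype.ext coe_binVal_ones)

theorem exists_eq_one_of_binVal_pos {w : BinSeq} (h : 0 < binVal w) : ∃ n, w n = 1 := by
  by_contra! hw
  obtain rfl : w = fun _ => 0 := funext fun n => by have := hw n; omega
  exact h.ne' (Subtype.ext coe_binVal_zeros)

theorem dense_binVal_preimage_orbit {x : I} (h0 : 0 < x) (h1 : x < 1) :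
    Dense (binVal ⁻¹' MulAction.orbit ThompsonF x) := by
  obtain ⟨z, rfl⟩ := surjective_binVal x
  obtain ⟨m, hm⟩ := exists_eq_zero_of_binVal_lt_one h1
  obtain ⟨n, hn⟩ := exists_eq_one_of_binVal_pos h0
  obtain ⟨s, z, hs, rfl⟩ := exists_eq_prepend (max m n + 1) z
  have hs0 : 0 ∈ s := hm ▸ prepend_apply_mem (by omega) z
  have hs1 : 1 ∈ s := hn ▸ prepend_apply_mem (by omega) z
  refine fun w => mem_closure_iff_nhds.mpr fun U hU => ?_
  obtain ⟨u, v, -, rfl, huU⟩ := exists_range_prepend_subset hU 0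
  obtain ⟨f, hf⟩ := (prefixEquiv_one_zero hs0 hs1).trans
    (prefixEquiv_one_zero (u := u ++ [0, 1]) (by simp) (by simp)).symm
  refine ⟨f • prepend s z, huU ?_, f, (cantor_smul_spec f _).1.symm⟩
  rw [hf, prepend_append]
  exact mem_range_self _

theorem exists_carriesPrefix_cons (u : List (Fin 2)) : ∃ (f : ThompsonF) (s t : List (Fin 2)),
    CarriesPrefix f (u ++ [0]) (0 :: s) ∧ CarriesPrefix f (u ++ [1]) (1 :: t) := by
  by_cases h0 : 0 ∈ u
  · by_cases h1 : 1 ∈ u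
    · obtain ⟨f, hf⟩ := prefixEquiv_one_zero h0 h1
      exact ⟨x₀ * x₁⁻¹ * f, _, _,
        (carriesPrefix_x₀_one_zero.mul carriesPrefix_x₁_one_zero.inv).mul (hf.append [0]),
        ((carriesPrefix_x₀_one_one.append [0]).mul carriesPrefix_x₁_one_one_zero.inv).mul
          (hf.append [1])⟩
    · obtain ⟨f, hf⟩ := prefixEquiv_zero (List.ne_nil_of_mem h0) h1
      exact ⟨x₀⁻¹ * f, _, _, carriesPrefix_x₀_zero.inv.mul (hf.append [0]),
        carriesPrefix_x₀_one_zero.inv.mul (hf.append [1])⟩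
  · rcases eq_or_ne u [] with rfl | hu
    · exact ⟨1, _, _, .one _, .one _⟩
    · obtain ⟨f, hf⟩ := prefixEquiv_one hu h0
      exact ⟨x₀ * f, _, _, carriesPrefix_x₀_one_zero.mul (hf.append [0]),
        carriesPrefix_x₀_one_one.mul (hf.append [1])⟩

theorem exists_smul_apply_zero_ne {w v : BinSeq} (h : w ≠ v) :
    ∃ f : ThompsonF, (f • w) 0 ≠ (f • v) 0 := by
  obtain ⟨u, a, b, w, v, hab, rfl, rfl⟩ := exists_prepend_cons_of_ne h
  obtain ⟨f, s, t, hf0, hf1⟩ := exists_carriesPrefix_cons u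
  refine ⟨f, ?_⟩
  rw [← prepend_append, ← prepend_append]
  obtain ⟨rfl, rfl⟩ | ⟨rfl, rfl⟩ : a = 0 ∧ b = 1 ∨ a = 1 ∧ b = 0 := by omega
  all_goals
    rw [hf0, hf1, prepend_cons_zero, prepend_cons_zero]
    exact hab

theorem eq_zero_or_eq_one_of_x₀_smul_eq {t : I} (h : x₀ • t = t) : t = 0 ∨ t = 1 := by
  rw [← Subtype.coe_inj, coe_x₀_smul, x₀Fun] at h
  rw [← Subtype.coe_inj, ← Subtype.coe_inj, Icc.coe_zero, Icc.coe_one]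
  split_ifs at h
  · exact .inl (by linarith)
  · linarith
  · exact .inr (by linarith)

theorem exists_x₀_smul_prepend_ne (u : List (Fin 2)) :
    ∃ w : BinSeq, x₀ • prepend u w ≠ prepend u w := by
  refine ⟨prepend [0, 1] fun _ => 0, fun h => ?_⟩
  rcases eq_zero_or_eq_one_of_x₀_smul_eq (cantor_smul_eq_self_iff.mp h) with h | h
  · have := binVal_eq_zero (congrArg Subtype.val h) (1 + u.length)
    rw [prepend_apply_add] at this
    exact one_ne_zero this
  · have := binVal_eq_one (congrArg Subtype.val h) (0 + u.length)
    rw [prepend_apply_add] at this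
    exact zero_ne_one this

theorem x₁_mem_germStabilizer_iff {w : BinSeq} : x₁ ∈ germStabilizer ThompsonF w ↔ w 0 = 0 := by
  rw [mem_germStabilizer]
  rcases exists_eq_prepend_singleton w with ⟨z, rfl⟩ | ⟨z, rfl⟩
  · refine iff_of_true ?_ rfl
    filter_upwards [(isOpen_range_prepend [0]).mem_nhds (mem_range_self z)]
    rintro _ ⟨y, rfl⟩
    exact carriesPrefix_x₁_zero y
  · refine iff_of_false (fun h => ?_) one_ne_zero
    obtain ⟨u, v, -, -, hu⟩ :=
      exists_range_prepend_subset ((continuous_prepend [1]).continuousAt.preimage_mem_nhds h) 0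
    obtain ⟨y, hy⟩ := exists_x₀_smul_prepend_ne u
    have hfix : x₁ • prepend [1] (prepend u y) = prepend [1] (prepend u y) := hu ⟨y, rfl⟩
    exact hy (prepend_injective [1] ((x₁_smul_prepend_one _).symm.trans hfix))

theorem injective_germStabilizer :
    Function.Injective (germStabilizer ThompsonF : BinSeq → Subgroup ThompsonF) := by
  intro w v h
  by_contra hne
  obtain ⟨f, hf⟩ := exists_smul_apply_zero_ne hne
  have hiff : (f • w) 0 = 0 ↔ (f • v) 0 = 0 := by
    rw [← x₁_mem_germStabilizer_iff, ← x₁_mem_germStabilizer_iff, mem_germStabilizer_smul_iff,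
      mem_germStabilizer_smul_iff, h]
  omega

/-! ### Schreier graphs of points of the orbit -/

theorem injective_germGraph : Function.Injective (germGraph ![x₀, x₁] : BinSeq → _) :=
  germGraph_injective surjective_lift_x₀_x₁ injective_germStabilizer

theorem schreierGraph_binVal (w : BinSeq) :
    schreierGraph (binVal w) = pointGraph ![x₀, x₁] w := by
  refine GraphSpace.loopGroup_injective (Subgroup.ext fun g => ?_)
  change g ∈ (pointGraph ![x₀, x₁] (binVal w)).loopGroup ↔ _
  rw [mem_loopGroup_pointGraph, mem_loopGroup_pointGraph, cantor_smul_eq_self_iff]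

theorem schreierFamily_eq_image_pointGraph (x : I) :
    schreierFamily x = pointGraph ![x₀, x₁] '' (binVal ⁻¹' MulAction.orbit ThompsonF x) := by
  rw [schreierFamily, ← image_preimage_eq (MulAction.orbit ThompsonF x) surjective_binVal,
    image_image, image_preimage_eq _ surjective_binVal]
  exact image_congr fun w _ => schreierGraph_binVal w

theorem perfectKernel_closure_schreierFamily {x : I} (h0 : 0 < x) (h1 : x < 1) :
    CantorBendixson.perfectKernel (closure (schreierFamily x)) =
      range (germGraph ![x₀, x₁] : BinSeq → _) := by
  rw [schreierFamily_eq_image_pointGraph]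
  exact perfectKernel_closure_image_pointGraph injective_germGraph
    (dense_binVal_preimage_orbit h0 h1)

theorem dyadicKernel_eq_range : dyadicKernel = range (germGraph ![x₀, x₁] : BinSeq → _) :=
  perfectKernel_closure_schreierFamily (Subtype.coe_lt_coe.mp (by norm_num))
    (Subtype.coe_lt_coe.mp (by norm_num))

theorem smul_schreierGraph (g : FreeGroup (Fin 2)) (y : I) :
    g • schreierGraph y = schreierGraph (FreeGroup.lift ![x₀, x₁] g • y) :=
  smul_pointGraph ![x₀, x₁] g y

namespace IsSchreierSystem

variable {x : I} {α β : ThompsonF →* (closure (schreierFamily x) ≃ₜ closure (schreierFamily x))}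

theorem coe_apply_lift (hα : IsSchreierSystem x α) (g : FreeGroup (Fin 2))
    (Γ : closure (schreierFamily x)) :
    (α (FreeGroup.lift ![x₀, x₁] g) Γ : GraphSpace (Fin 2)) = g • (Γ : GraphSpace (Fin 2)) := by
  have hdense : DenseRange (inclusion (subset_closure (s := schreierFamily x))) :=
    (denseRange_inclusion_iff _).mpr subset_rfl
  refine congrFun (hdense.equalizer (continuous_subtype_val.comp (α _).continuous)
    (continuous_subtype_val.const_smul g) (funext ?_)) Γ
  rintro ⟨_, y, hy, rfl⟩
  exact (hα _ y hy).trans (smul_schreierGraph g y).symm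

theorem unique (hα : IsSchreierSystem x α) (hβ : IsSchreierSystem x β) : α = β := by
  refine MonoidHom.ext fun f => Homeomorph.ext fun Γ => Subtype.ext ?_
  obtain ⟨g, rfl⟩ := surjective_lift_x₀_x₁ f
  rw [hα.coe_apply_lift, hβ.coe_apply_lift]

theorem coe_apply_of_coe_eq_germGraph (hα : IsSchreierSystem x α) (f : ThompsonF)
    {Γ : closure (schreierFamily x)} {w : BinSeq} (hΓ : Γ = germGraph ![x₀, x₁] w) :
    (α f Γ : GraphSpace (Fin 2)) = germGraph ![x₀, x₁] (f • w) := by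
  obtain ⟨g, rfl⟩ := surjective_lift_x₀_x₁ f
  rw [hα.coe_apply_lift, hΓ, smul_germGraph]

end IsSchreierSystem

theorem exists_isSchreierSystem (x : I) : ∃ α, IsSchreierSystem x α := by
  have hinv (g : FreeGroup (Fin 2)) : ∀ Γ ∈ schreierFamily x, g • Γ ∈ schreierFamily x := by
    rintro _ ⟨y, hy, rfl⟩
    exact ⟨_, MulAction.mem_orbit_of_mem_orbit _ hy, (smul_schreierGraph g y).symm⟩
  obtain ⟨α, hα⟩ := exists_monoidHom_closure hinv surjective_lift_x₀_x₁ <| by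
    rintro g hg _ ⟨y, -, rfl⟩
    rw [smul_schreierGraph, MonoidHom.mem_ker.mp hg, one_smul]
  refine ⟨α, fun f y hy => ?_⟩
  obtain ⟨g, rfl⟩ := surjective_lift_x₀_x₁ f
  rw [hα, smul_schreierGraph]

theorem existsUnique_isSchreierSystem (x : I) : ∃! α, IsSchreierSystem x α :=
  (exists_isSchreierSystem x).elim fun α hα => ⟨α, hα, fun _ hβ => hβ.unique hα⟩

/-- The word `w` corresponds to the graph of the germ stabilizer of `w`. -/
noncomputable def germHomeomorph : BinSeq ≃ₜ dyadicKernel :=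
  (continuous_germGraph.isClosedEmbedding
    injective_germGraph).isEmbedding.toHomeomorph.trans
    (Homeomorph.setCongr dyadicKernel_eq_range.symm)

theorem mainTheorem11 :
    ∃ ψ : dyadicKernel ≃ₜ BinSeq, ∀ x : I, 0 < x → x < 1 →
      CantorBendixson.perfectKernel (closure (schreierFamily x)) = dyadicKernel ∧
      (∃! α, IsSchreierSystem x α) ∧
      ∀ α, IsSchreierSystem x α →
        ∀ (f : ThompsonF) (Γ : closure (schreierFamily x))
          (hΓ : (Γ : GraphSpace (Fin 2)) ∈ dyadicKernel),
          ∃ hfΓ : (α f Γ : GraphSpace (Fin 2)) ∈ dyadicKernel,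
            ψ ⟨α f Γ, hfΓ⟩ = f • ψ ⟨Γ, hΓ⟩ := by
  refine ⟨germHomeomorph.symm, fun x h0 h1 =>
    ⟨(perfectKernel_closure_schreierFamily h0 h1).trans dyadicKernel_eq_range.symm,
      existsUnique_isSchreierSystem x, fun α hα f Γ hΓ => ?_⟩⟩
  obtain ⟨w, hw⟩ := germHomeomorph.surjective ⟨Γ, hΓ⟩
  have hfΓ : (germHomeomorph (f • w) : GraphSpace (Fin 2)) = α f Γ :=
    (hα.coe_apply_of_coe_eq_germGraph f (congrArg Subtype.val hw).symm).symm
  refine ⟨hfΓ ▸ (germHomeomorph (f • w)).2, ?_⟩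
  rw [← hw, germHomeomorph.symm_apply_apply, germHomeomorph.symm_apply_eq]
  exact Subtype.ext hfΓ.symm
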